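/- Let $m\ge 2$ and let $M$ be a simply connected (in particular connected) Hausdorff smooth manifold of dimension $m$ without boundary. An affine structure on $M$ is a smooth torsion-free connection $\nabla$ on $TM$. For $g\in C^\infty(M)$ let ${}^g\nabla$ be the connection ${}^g\nabla_XY:=\nabla_XY+X(g)Y+Y(g)X$; $\nabla$ is called strongly projectively flat if ${}^g\nabla$ is flat (has vanishing curvature) for some $g\in C^\infty(M)$. Let $R(X,Y)Z=\nabla_X\nabla_YZ-\nabla_Y\nabla_XZ-\nabla_{[X,Y]}Z$ be the curvature, $\rho_\nabla(Y,Z)=\operatorname{Tr}(X\mapsto R(X,Y)Z)$ the Ricci tensor, $\rho_{\nabla,s}(Y,Z)=\frac12(\rho_\nabla(Y,Z)+\rho_\nabla(Z,Y))$ its symmetrization, $(\mathcal H_\nabla f)(X,Y)=X(Yf)-(\nabla_XY)f$ the Hessian, and $$\mathcal Q(M,\nabla):=\Big\{f\in C^\infty(M)\;:\;\mathcal H_\nabla f+\tfrac1{m-1}\,f\,\rho_{\nabla,s}=0\Big\}.$$ **Theorem 1.4.** Let $\nabla_1,\nabla_2$ be two strongly projectively flat affine structures on $M$, and let $\Xi:M\to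 M$ be a (smooth) diffeomorphism. 1. If $\mathcal Q(M,\nabla_1)=\mathcal Q(M,\nabla_2)$, then $\nabla_1=\nabla_2$. 2. If $\Xi^*\mathcal Q(M,\nabla_1)=\mathcal Q(M,\nabla_2)$, then $\Xi^*\nabla_1=\nabla_2$. Here $\Xi^*\mathcal Q(M,\nabla_1)=\{f\circ\Xi : f\in\mathcal Q(M,\nabla_1)\}$ and $(\Xi^*\nabla_1)_XY=(\Xi_*)^{-1}\big((\nabla_1)_{\Xi_*X}(\Xi_*Y)\big)$. -/

import Mathlib

open Bundle VectorField
open scoped Manifold ContDiff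

noncomputable section

namespace AffineGeometry

/-- Smooth vector fields on the `m`-dimensional manifold `M`. -/
abbrev SmoothVF (m : ℕ) (M : Type*) [TopologicalSpace M]
    [ChartedSpace (EuclideanSpace ℝ (Fin m)) M] [IsManifold (𝓡 m) ∞ M] :=
  Cₛ^∞⟮𝓡 m; EuclideanSpace ℝ (Fin m), (TangentSpace (𝓡 m) : M → Type _)⟯

/-- Connections on the tangent bundle of `M`, without regularity assumptions on the coefficients.
Mathlib writes `∇ Y x (X x)` for the value of `∇_X Y` at `x`. -/
abbrev TangentConnection (m : ℕ) (M : Type*) [TopologicalSpace M]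
    [ChartedSpace (EuclideanSpace ℝ (Fin m)) M] [IsManifold (𝓡 m) ∞ M] :=
  CovariantDerivative (𝓡 m) (EuclideanSpace ℝ (Fin m)) (TangentSpace (𝓡 m) : M → Type _)

/-- An affine structure on `M`: a smooth torsion-free connection on the tangent bundle. -/
structure AffineStructure (m : ℕ) (M : Type*) [TopologicalSpace M]
    [ChartedSpace (EuclideanSpace ℝ (Fin m)) M] [IsManifold (𝓡 m) ∞ M] where
  /-- The underlying connection. -/
  conn : TangentConnection m M
  /-- `∇ Y` is smooth whenever `Y` is. -/
  smooth : CovariantDerivative.ContMDiffCovariantDerivative conn ∞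
  /-- The torsion tensor `∇_X Y - ∇_Y X - [X, Y]` vanishes. -/
  torsion_free : conn.torsion = 0

variable {m : ℕ} {M : Type*} [TopologicalSpace M]
  [ChartedSpace (EuclideanSpace ℝ (Fin m)) M] [IsManifold (𝓡 m) ∞ M]

/-- The vector field `Y` is differentiable at the point `x`. -/
abbrev VFDiffAt (Y : Π x : M, TangentSpace (𝓡 m) x) (x : M) : Prop :=
  MDifferentiableAt (𝓡 m) ((𝓡 m).prod 𝓘(ℝ, EuclideanSpace ℝ (Fin m)))
    (fun y ↦ (⟨y, Y y⟩ : TangentBundle (𝓡 m) M)) x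

/-- Equality of connections. Mathlib's covariant derivatives carry arbitrary values on vector
fields that are not differentiable at the point considered; two connections are the same when they
agree on all vector fields wherever those are differentiable. -/
def SameConnection (D D' : TangentConnection m M) : Prop :=
  ∀ (Y : Π x : M, TangentSpace (𝓡 m) x) (x : M),
    VFDiffAt Y x → D Y x = D' Y x

/-- The curvature operator
`R(X, Y) Z = ∇_X ∇_Y Z - ∇_Y ∇_X Z - ∇_{[X, Y]} Z` at the point `x`. -/
def curvature (D : TangentConnection m M) (X Y Z : Π x : M, TangentSpace (𝓡 m) x) (x : M) :
    TangentSpace (𝓡 m) x :=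
  D (fun q ↦ D Z q (Y q)) x (X x) - D (fun q ↦ D Z q (X q)) x (Y x)
    - D Z x (mlieBracket (𝓡 m) X Y x)

/-- A connection is flat if its curvature vanishes. -/
def IsFlat (D : TangentConnection m M) : Prop :=
  ∀ (X Y Z : SmoothVF m M) (x : M), curvature D X Y Z x = 0

/-- The symmetric bilinear map `(v, w) ↦ φ(v) w + φ(w) v` determined by a linear form `φ`. -/
def symProd (φ : EuclideanSpace ℝ (Fin m) →L[ℝ] ℝ) :
    EuclideanSpace ℝ (Fin m) →L[ℝ] EuclideanSpace ℝ (Fin m) →L[ℝ] EuclideanSpace ℝ (Fin m) :=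
  φ.smulRight (ContinuousLinearMap.id ℝ _) + (φ.smulRight (ContinuousLinearMap.id ℝ _)).flip

/-- The perturbed connection `^g∇_X Y = ∇_X Y + X(g) Y + Y(g) X`. -/
def perturb (D : TangentConnection m M) (g : C^∞⟮𝓡 m, M; 𝓘(ℝ, ℝ), ℝ⟯) : TangentConnection m M :=
  D.addOneForm fun x ↦ symProd (mvfderiv (𝓡 m) g x)

lemma perturb_apply (D : TangentConnection m M) (g : C^∞⟮𝓡 m, M; 𝓘(ℝ, ℝ), ℝ⟯)
    (X Y : Π x : M, TangentSpace (𝓡 m) x) (x : M) :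
    perturb D g Y x (X x) =
      D Y x (X x) + mvfderiv (𝓡 m) g x (X x) • Y x + mvfderiv (𝓡 m) g x (Y x) • X x := by
  rw [add_assoc, add_comm (mvfderiv (𝓡 m) g x (X x) • Y x)]
  rfl

/-- `D` and `D'` are strongly projectively equivalent: `D' = ^g D` for some smooth `g`. -/
def StronglyProjectivelyEquivalent (D D' : TangentConnection m M) : Prop :=
  ∃ g : C^∞⟮𝓡 m, M; 𝓘(ℝ, ℝ), ℝ⟯, SameConnection D' (perturb D g)

namespace AffineStructure

/-- Strongly projectively flat: strongly projectively equivalent to a flat connection. -/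
def IsStronglyProjectivelyFlat (A : AffineStructure m M) : Prop :=
  ∃ A₀ : AffineStructure m M, IsFlat A₀.conn ∧ StronglyProjectivelyEquivalent A.conn A₀.conn

lemma mdifferentiableAt_conn (A : AffineStructure m M) (Z : SmoothVF m M)
    {X : Π x : M, TangentSpace (𝓡 m) x} {x : M}
    (hX : VFDiffAt X x) : VFDiffAt (fun q ↦ A.conn Z q (X q)) x := by
  have hZ := A.smooth.contMDiff.contMDiff (σ := fun x ↦ Z x) (by
    simpa using! Z.contMDiff.contMDiffOn)
  have h1 := (hZ.contMDiffAt Filter.univ_mem).mdifferentiableAt (x := x) (by simp)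
  exact MDifferentiableAt.clm_bundle_apply h1 hX

/-- `R(X, Y) Z` at `x` is tensorial in `X`. -/
lemma tensorialAt_curvature (A : AffineStructure m M) (Y Z : SmoothVF m M) (x : M) :
    TensorialAt (𝓡 m) (EuclideanSpace ℝ (Fin m)) (fun X ↦ curvature A.conn X Y Z x) x where
  smul {f X} hf hX := by
    have h := A.conn.isCovariantDerivativeOn (s := Set.univ) |>.leibniz
      (A.mdifferentiableAt_conn Z hX) hf
    have e : (fun q ↦ A.conn Z q ((f • X) q)) = f • (fun q ↦ A.conn Z q (X q)) := by
      ext1 q; simp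
    simp only [curvature]
    rw [e, h, mlieBracket_smul_left hf hX]
    simp
    module
  add {X X'} hX hX' := by
    have h := A.conn.isCovariantDerivativeOn (s := Set.univ) |>.add
      (A.mdifferentiableAt_conn Z hX) (A.mdifferentiableAt_conn Z hX')
    have e : (fun q ↦ A.conn Z q ((X + X') q)) =
        (fun q ↦ A.conn Z q (X q)) + (fun q ↦ A.conn Z q (X' q)) := by
      ext1 q; simp
    simp only [curvature]
    rw [e, h, mlieBracket_add_left hX hX']
    simp
    module

/-- The Ricci tensor `ρ(Y, Z) = Tr (v ↦ R(v, Y) Z)` at the point `x`. -/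
def ricci (A : AffineStructure m M) (Y Z : SmoothVF m M) (x : M) : ℝ :=
  LinearMap.trace ℝ (TangentSpace (𝓡 m) x)
    (TensorialAt.mkHom (fun X ↦ curvature A.conn X Y Z x) x
      (A.tensorialAt_curvature Y Z x)).toLinearMap

/-- The symmetric Ricci tensor `ρ_s(Y, Z) = (ρ(Y, Z) + ρ(Z, Y)) / 2`. -/
def ricciSym (A : AffineStructure m M) (Y Z : SmoothVF m M) (x : M) : ℝ :=
  (A.ricci Y Z x + A.ricci Z Y x) / 2

/-- The Hessian `(H f)(X, Y) = X (Y f) - (∇_X Y) f` at the point `x`; in coordinates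
`∂_i ∂_j f - Γ_{ij}^k ∂_k f`. -/
def hessian (A : AffineStructure m M) (f : M → ℝ) (X Y : SmoothVF m M) (x : M) : ℝ :=
  mvfderiv (𝓡 m) (fun q ↦ mvfderiv (𝓡 m) f q (Y q)) x (X x)
    - mvfderiv (𝓡 m) f x (A.conn Y x (X x))

/-- The space `𝒬` of smooth solutions of `H f + (m - 1)⁻¹ f ρ_s = 0`. -/
def solutionSpace (A : AffineStructure m M) : Set (M → ℝ) :=
  {f | ContMDiff (𝓡 m) 𝓘(ℝ, ℝ) ∞ f ∧ ∀ (X Y : SmoothVF m M) (x : M),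
    A.hessian f X Y x + 1 / ((m : ℝ) - 1) * f x * A.ricciSym X Y x = 0}

end AffineStructure

/-- The pullback `(Ξ^* ∇)_X Y = Ξ_*⁻¹ (∇_{Ξ_* X} (Ξ_* Y))` of a connection by a diffeomorphism;
here `Ξ_* Y` is the pullback of `Y` by the inverse of `Ξ`. -/
def pullbackConnection (Ξ : M ≃ₘ⟮𝓡 m, 𝓡 m⟯ M) (D : TangentConnection m M) :
    TangentConnection m M where
  toFun Y x :=
    (mfderiv (𝓡 m) (𝓡 m) Ξ x).inverse ∘L
      (D (mpullback (𝓡 m) (𝓡 m) Ξ.symm Y) (Ξ x)) ∘L (mfderiv (𝓡 m) (𝓡 m) Ξ x)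
  isCovariantDerivativeOnUniv := by
    have hinv (q : M) : (mfderiv (𝓡 m) (𝓡 m) Ξ.symm q).IsInvertible :=
      ⟨Ξ.symm.mfderivToContinuousLinearEquiv (by simp) q, rfl⟩
    have hdiff {Y : Π x : M, TangentSpace (𝓡 m) x} {x : M} (hY : VFDiffAt Y x) :
        VFDiffAt (mpullback (𝓡 m) (𝓡 m) Ξ.symm Y) (Ξ x) := by
      refine MDifferentiableAt.mpullback_vectorField (n := ∞) ?_
        Ξ.symm.contMDiff.contMDiffAt (hinv _) ENat.LEInfty.out
      simpa using hY
    refine ⟨fun {Y Y' x} hY hY' _ ↦ ?_, fun {Y g x} hY hg _ ↦ ?_⟩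
    · rw [mpullback_add, D.isCovariantDerivativeOnUniv.add (hdiff hY) (hdiff hY')]
      ext v
      simp
    · have hΞ : MDifferentiableAt (𝓡 m) (𝓡 m) Ξ x := Ξ.contMDiff.mdifferentiable (by simp) x
      have hΞi : (mfderiv (𝓡 m) (𝓡 m) Ξ x).IsInvertible :=
        ⟨Ξ.mfderivToContinuousLinearEquiv (by simp) x, rfl⟩
      have hg' : MDifferentiableAt (𝓡 m) 𝓘(ℝ, ℝ) (g ∘ Ξ.symm) (Ξ x) := by
        refine MDifferentiableAt.comp (I' := 𝓡 m) (Ξ x) (by simpa using hg) ?_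
        exact Ξ.symm.contMDiff.mdifferentiable (by simp) _
      have hd (v : TangentSpace (𝓡 m) x) : mvfderiv (𝓡 m) (g ∘ Ξ.symm) (Ξ x)
          (mfderiv (𝓡 m) (𝓡 m) Ξ x v) = mvfderiv (𝓡 m) g x v := by
        rw [← mvfderiv_comp_apply x hg' hΞ]
        congr 2
        ext y
        simp
      have hY' : (mfderiv (𝓡 m) (𝓡 m) Ξ x).inverse
          (mpullback (𝓡 m) (𝓡 m) Ξ.symm Y (Ξ x)) = Y x := by
        have h := mpullbackWithin_comp_of_left (I := 𝓡 m) (I' := 𝓡 m) (I'' := 𝓡 m) (V := Y)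
          (g := Ξ.symm) (f := Ξ) (s := Set.univ) (t := Set.univ) (x₀ := x)
          hΞ.mdifferentiableWithinAt (Set.mapsTo_univ _ _) (uniqueMDiffWithinAt_univ _)
          (by simpa using hinv (Ξ x))
        have e : (Ξ.symm ∘ Ξ : M → M) = id := by
          ext y
          simp
        rw [e] at h
        simp only [mpullbackWithin_univ, mpullback_id] at h
        exact h.symm
      rw [mpullback_smul, D.isCovariantDerivativeOnUniv.leibniz (hdiff hY) hg']
      ext v
      simp [hd, hY']

end AffineGeometry

end

/-! The connection can be read off from the solutions that vanish at a point. If `f` is a solution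
with `f x = 0`, the Ricci term drops out at `x` and the equation says `(∇_X Y) f = X (Y f)` there.
The right side does not involve `∇`, so `∇_X Y` is known at `x` as soon as the differentials at `x`
of such solutions fill the whole cotangent space. The same comparison of `f` with `f ∘ Ξ` gives the
statement for a diffeomorphism (`sameConnection_pullbackConnection`). Only one inclusion of solution
spaces and enough solutions for the first connection are needed; part 1 is the case of the identity.

It remains to produce solutions (`exists_mem_solutionSpace`). Write `∇` as the projective change of
a flat `∇⁰` by a function `h`. Its Ricci tensor is `-(m - 1) (Hess⁰ h - dh ⊗ dh)`, and a direct
computation shows that `e^h f` is a solution whenever `Hess⁰ f = 0` (`exp_mul_mem_solutionSpace`).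
So the question becomes whether a flat torsion-free connection on a simply connected manifold has
globally defined affine functions with any given value and differential at a point
(`exists_affine`).

In a chart, `Hess⁰ f = 0` is a linear total differential system for the jet `(f, df)`. Its
integrability condition is the vanishing of torsion and curvature (`integrableAt_jetCoeff`), so a
linear Frobenius theorem, proved by Picard iteration along rays (`exists_ball_solutions`), gives
local solutions with arbitrary jets. Two of them with the same jet at a point agree nearby, hence
they form a local system with discrete fibre. The associated bundle is a covering, and simple
connectedness provides a global section (`exists_section_of_localSystem`). -/

noncomputable section

namespace AffineGeometry

set_option linter.unusedSectionVars false

/-! ### Picard iteration along rays for linear total differential equations -/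

section Frobenius

open Set Filter Topology MeasureTheory

variable {E F : Type*} [NormedAddCommGroup E] [NormedSpace ℝ E] [FiniteDimensional ℝ E]
  [NormedAddCommGroup F] [NormedSpace ℝ F]

/-- Differentiation of `∫₀¹ G(x, t) dt` under the integral sign for `G` of class `C¹`. -/
lemma hasFDerivAt_integral_of_contDiff {G : E → ℝ → F}
    (hG : ContDiff ℝ 1 (Function.uncurry G)) :
    (Continuous fun p : E × ℝ ↦ fderiv ℝ (G · p.2) p.1) ∧
    ∀ x, HasFDerivAt (fun x ↦ ∫ t in (0 : ℝ)..1, G x t)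
      (∫ t in (0 : ℝ)..1, fderiv ℝ (G · t) x) x := by
  have hc : Continuous fun p : E × ℝ ↦ fderiv ℝ (G · p.2) p.1 := by
    have h : ContDiff ℝ 1 (Function.uncurry fun (p : E × ℝ) (x : E) ↦ G x p.2) :=
      hG.comp (g := Function.uncurry G) (f := fun q : (E × ℝ) × E ↦ (q.2, q.1.2)) (by fun_prop)
    exact (ContDiff.fderiv (n := 0) (m := 1) h contDiff_fst le_rfl).continuous
  refine ⟨hc, fun x ↦ ?_⟩
  have hK : IsCompact (Metric.closedBall x 1 ×ˢ Icc (0 : ℝ) 1) :=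
    (isCompact_closedBall x 1).prod isCompact_Icc
  obtain ⟨C, hC⟩ := hK.exists_bound_of_continuousOn hc.continuousOn
  have hcont (x : E) : Continuous (G x) := hG.continuous.comp (by fun_prop : Continuous (x, ·))
  refine intervalIntegral.hasFDerivAt_integral_of_dominated_of_fderiv_le
    (F' := fun x t ↦ fderiv ℝ (G · t) x) (bound := fun _ ↦ C)
    (Metric.closedBall_mem_nhds x one_pos) ?_ ?_ ?_ ?_ ?_ ?_
  · exact Eventually.of_forall fun x ↦ (hcont x).aestronglyMeasurable
  · exact (hcont x).intervalIntegrable _ _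
  · exact (hc.comp (by fun_prop : Continuous (x, ·))).aestronglyMeasurable
  · refine Eventually.of_forall fun t ht z hz ↦ hC (z, t) ⟨hz, ?_⟩
    rw [uIoc_of_le zero_le_one] at ht
    exact Ioc_subset_Icc_self ht
  · exact intervalIntegrable_const
  · refine Eventually.of_forall fun t _ z _ ↦ ?_
    have : ContDiff ℝ 1 (G · t) := hG.comp (f := fun x : E ↦ (x, t)) (by fun_prop)
    exact (this.differentiable one_ne_zero z).hasFDerivAt

/-- One step of the Picard iteration, along the rays issued from `y`, for the linear total
differential equation `Du(x) v = A(x) v u(x)` with initial value `u(y) = c`. -/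
noncomputable def picardStep (A : E → E →L[ℝ] F →L[ℝ] F) (y : E) (c : F) (w : E → F) (x : E) : F :=
  c + ∫ t in (0 : ℝ)..1, A (y + t • (x - y)) (x - y) (w (y + t • (x - y)))

variable {A : E → E →L[ℝ] F →L[ℝ] F}

omit [FiniteDimensional ℝ E] in
lemma contDiff_picard_integrand (hA : ContDiff ℝ 1 A) (y : E) {w : E → F} (hw : ContDiff ℝ 1 w) :
    ContDiff ℝ 1 (Function.uncurry fun (x : E) (t : ℝ) ↦
      A (y + t • (x - y)) (x - y) (w (y + t • (x - y)))) := by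
  simp only [Function.uncurry_def]
  have hz : ContDiff ℝ 1 fun p : E × ℝ ↦ y + p.2 • (p.1 - y) := by fun_prop
  exact ((hA.comp hz).clm_apply (contDiff_fst.sub contDiff_const)).clm_apply (hw.comp hz)

lemma contDiff_picardStep (hA : ContDiff ℝ 1 A) (y : E) (c : F) {w : E → F}
    (hw : ContDiff ℝ 1 w) : ContDiff ℝ 1 (picardStep A y c w) := by
  obtain ⟨h1, h2⟩ := hasFDerivAt_integral_of_contDiff (contDiff_picard_integrand hA y hw)
  refine contDiff_const.add (contDiff_one_iff_fderiv.2 ⟨fun x ↦ (h2 x).differentiableAt, ?_⟩)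
  rw [funext fun x ↦ (h2 x).fderiv]
  exact intervalIntegral.continuous_parametric_intervalIntegral_of_continuous' (f := fun x t ↦ _)
    h1 0 1

/-- `A` satisfies the integrability condition of `Du(x) v = A(x) v u(x)` at the point `x`. -/
def IntegrableAt (A : E → E →L[ℝ] F →L[ℝ] F) (x : E) : Prop :=
  ∀ v w c, fderiv ℝ A x v w c + A x w (A x v c) = fderiv ℝ A x w v c + A x v (A x w c)

omit [NormedSpace ℝ F] in
lemma combine_smul [Module ℝ F] (t : ℝ) {p p' b b' q r r' : F} (h : p + b = p' + b') :
    t • p + q + t • r - (t • p' + q + t • r') = t • (r - b - (r' - b')) := by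
  rw [show p = p' + b' - b from eq_sub_of_add_eq h]
  module

variable [CompleteSpace F]

-- A limit of the iteration solves the equation only in the radial direction; this identity controls
-- the other directions. It expresses the defect of the new iterate, measured against the old one,
-- through the defect `Dw - A w` of the old iterate. Differentiate under the integral sign, write `A
-- x v (w x)` as the integral of the `t`-derivative of `t • A (z t) v (w (z t))`, and exchange the
-- two arguments of `DA` by integrability.
set_option synthInstance.maxHeartbeats 200000 in
lemma fderiv_picardStep_sub (hA : ContDiff ℝ 1 A) {y x : E} {c : F} {w : E → F}
    (hw : ContDiff ℝ 1 w)
    (hint : ∀ t ∈ Icc (0 : ℝ) 1, IntegrableAt A (y + t • (x - y))) (v : E) :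
    fderiv ℝ (picardStep A y c w) x v - A x v (w x) =
      ∫ t in (0 : ℝ)..1, t •
        (A (y + t • (x - y)) (x - y)
          (fderiv ℝ w (y + t • (x - y)) v - A (y + t • (x - y)) v (w (y + t • (x - y)))) -
        A (y + t • (x - y)) v (fderiv ℝ w (y + t • (x - y)) (x - y) -
          A (y + t • (x - y)) (x - y) (w (y + t • (x - y))))) := by
  have hG := contDiff_picard_integrand hA y hw
  obtain ⟨h1, h2⟩ := hasFDerivAt_integral_of_contDiff hG
  have hAd (z) : HasFDerivAt A (fderiv ℝ A z) z := (hA.differentiable one_ne_zero z).hasFDerivAt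
  have hwd (z) : HasFDerivAt w (fderiv ℝ w z) z := (hw.differentiable one_ne_zero z).hasFDerivAt
  have hfd : Continuous (fderiv ℝ A) := hA.continuous_fderiv one_ne_zero
  have hfw : Continuous (fderiv ℝ w) := hw.continuous_fderiv one_ne_zero
  set z : ℝ → E := fun t ↦ y + t • (x - y) with hz
  have hzc : Continuous z := by fun_prop
  have hAc (v : E) {g : ℝ → F} (hg : Continuous g) : Continuous fun t ↦ A (z t) v (g t) :=
    ((hA.continuous.comp hzc).clm_apply continuous_const).clm_apply hg
  have hAc' (v v' : E) {g : ℝ → F} (hg : Continuous g) :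
      Continuous fun t ↦ fderiv ℝ A (z t) v v' (g t) :=
    (((hfd.comp hzc).clm_apply continuous_const).clm_apply continuous_const).clm_apply hg
  have hwc : Continuous fun t ↦ w (z t) := hw.continuous.comp hzc
  have hwc' (v : E) : Continuous fun t ↦ fderiv ℝ w (z t) v :=
    (hfw.comp hzc).clm_apply continuous_const
  have hci (v v' v'' : E) : IntervalIntegrable (fun t ↦ t • fderiv ℝ A (z t) v v' (w (z t))
      + A (z t) v'' (w (z t)) + t • A (z t) v' (fderiv ℝ w (z t) v)) volume 0 1 :=
    (((continuous_id.smul (hAc' v v' hwc)).add (hAc v'' hwc)).add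
      (continuous_id.smul (hAc v' (hwc' v)))).intervalIntegrable _ _
  have hderiv (t : ℝ) : fderiv ℝ (fun x' ↦ A (y + t • (x' - y)) (x' - y) (w (y + t • (x' - y)))) x v
      = t • fderiv ℝ A (z t) v (x - y) (w (z t)) + A (z t) v (w (z t))
        + t • A (z t) (x - y) (fderiv ℝ w (z t) v) := by
    have hzd : HasFDerivAt (fun x' : E ↦ y + t • (x' - y)) (t • ContinuousLinearMap.id ℝ E) x :=
      ((hasFDerivAt_id x).sub_const y |>.const_smul t).const_add y
    have hA1 : HasFDerivAt (fun x' : E ↦ A (y + t • (x' - y)))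
        ((fderiv ℝ A (z t)).comp (t • ContinuousLinearMap.id ℝ E)) x :=
      HasFDerivAt.comp (g := A) x (hAd (z t)) hzd
    have hw1 : HasFDerivAt (fun x' : E ↦ w (y + t • (x' - y)))
        ((fderiv ℝ w (z t)).comp (t • ContinuousLinearMap.id ℝ E)) x :=
      HasFDerivAt.comp (g := w) x (hwd (z t)) hzd
    have hA2 := hA1.clm_apply ((hasFDerivAt_id x).sub_const y)
    have hA3 := hA2.clm_apply hw1
    have hA4 := congrArg (· v) hA3.fderiv
    simp only [id] at hA4
    rw [hA4]
    simp [hz]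
    abel
  -- The factor `t` makes the boundary term at `t = 0` vanish.
  have hftc : A x v (w x) = ∫ t in (0 : ℝ)..1, (t • fderiv ℝ A (z t) (x - y) v (w (z t))
      + A (z t) v (w (z t)) + t • A (z t) v (fderiv ℝ w (z t) (x - y))) := by
    rw [intervalIntegral.integral_eq_sub_of_hasDerivAt (f := fun t ↦ t • A (z t) v (w (z t)))]
    · simp only [hz, one_smul, zero_smul, sub_zero, add_sub_cancel]
    · intro t _
      have hzd : HasDerivAt z (x - y) t := by
        simpa [hz] using ((hasDerivAt_id t).smul_const (x - y)).const_add y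
      have hA1 : HasDerivAt (fun t ↦ A (z t)) (fderiv ℝ A (z t) (x - y)) t :=
        HasFDerivAt.comp_hasDerivAt (l := A) t (hAd (z t)) hzd
      have hw1 : HasDerivAt (fun t ↦ w (z t)) (fderiv ℝ w (z t) (x - y)) t :=
        HasFDerivAt.comp_hasDerivAt (l := w) t (hwd (z t)) hzd
      have hA2 := hA1.clm_apply (hasDerivAt_const t v)
      have h4 := (hasDerivAt_id t).smul (hA2.clm_apply hw1)
      refine h4.congr_deriv ?_
      simp only [map_zero, add_zero, id, one_smul, smul_add]
      abel
    · exact hci _ _ _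
  have hcd : Continuous fun t ↦ fderiv ℝ (fun x' ↦ A (y + t • (x' - y)) (x' - y)
      (w (y + t • (x' - y)))) x := h1.comp (by fun_prop : Continuous (x, ·))
  have hfp : fderiv ℝ (picardStep A y c w) x v = ∫ t in (0 : ℝ)..1,
      (t • fderiv ℝ A (z t) v (x - y) (w (z t)) + A (z t) v (w (z t))
        + t • A (z t) (x - y) (fderiv ℝ w (z t) v)) := by
    rw [show picardStep A y c w = fun x ↦ c + _ from rfl, ((h2 x).const_add c).fderiv,
      ContinuousLinearMap.intervalIntegral_apply (hcd.intervalIntegrable _ _)]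
    simp only [hderiv]
  rw [hfp, hftc, ← intervalIntegral.integral_sub]
  · refine intervalIntegral.integral_congr fun t ht ↦ ?_
    rw [uIcc_of_le zero_le_one] at ht
    have h := hint t ht v (x - y) (w (z t))
    rw [(A (y + t • (x - y)) (x - y)).map_sub, (A (y + t • (x - y)) v).map_sub]
    exact combine_smul t h
  · exact hci _ _ _
  · exact hci _ _ _

end Frobenius

/-! ### Convergence of the iteration on small balls -/

section Frobenius

open Set Filter Topology MeasureTheory

variable {E F : Type*} [NormedAddCommGroup E] [NormedSpace ℝ E] [FiniteDimensional ℝ E]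
  [NormedAddCommGroup F] [NormedSpace ℝ F] {A : E → E →L[ℝ] F →L[ℝ] F}

omit [FiniteDimensional ℝ E] in
lemma ray_mem_ball {x y : E} {R : ℝ} (hx : x ∈ Metric.ball y R) {t : ℝ} (ht : t ∈ Icc (0 : ℝ) 1) :
    y + t • (x - y) ∈ Metric.ball y R := by
  rw [Metric.mem_ball, dist_eq_norm] at hx ⊢
  rw [add_sub_cancel_left, norm_smul, Real.norm_of_nonneg ht.1]
  exact (mul_le_of_le_one_left (norm_nonneg _) ht.2).trans_lt hx

lemma norm_picardStep_sub_le (hA : ContDiff ℝ 1 A) {y x : E} {R K δ : ℝ}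
    (hδ : 0 ≤ δ) (hK : ∀ x ∈ Metric.ball y R, ‖A x‖ ≤ K)
    (c : F) {w w' : E → F} (hw : ContDiff ℝ 1 w) (hw' : ContDiff ℝ 1 w')
    (h : ∀ x ∈ Metric.ball y R, ‖w x - w' x‖ ≤ δ) (hx : x ∈ Metric.ball y R) :
    ‖picardStep A y c w x - picardStep A y c w' x‖ ≤ K * R * δ := by
  have hci {w : E → F} (hw : ContDiff ℝ 1 w) : IntervalIntegrable
      (fun t : ℝ ↦ A (y + t • (x - y)) (x - y) (w (y + t • (x - y)))) volume 0 1 :=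
    ((contDiff_picard_integrand hA y hw).continuous.comp
      (by fun_prop : Continuous fun t : ℝ ↦ (x, t))).intervalIntegrable _ _
  have hK0 : 0 ≤ K := (norm_nonneg (A x)).trans (hK x hx)
  rw [picardStep, picardStep, add_sub_add_left_eq_sub, ← intervalIntegral.integral_sub
    (hci hw) (hci hw')]
  refine (intervalIntegral.norm_integral_le_of_norm_le_const (C := K * R * δ) fun t ht ↦ ?_).trans
    (by simp)
  rw [uIoc_of_le zero_le_one] at ht
  have hz := ray_mem_ball hx (Ioc_subset_Icc_self ht)
  rw [← map_sub]
  refine ((A _ _).le_opNorm _).trans ?_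
  have hxy : ‖x - y‖ ≤ R := by
    rw [Metric.mem_ball, dist_eq_norm] at hx
    exact hx.le
  gcongr
  · exact mul_nonneg hK0 ((norm_nonneg _).trans hxy)
  · refine ((A _).le_opNorm _).trans ?_
    gcongr
    exact hK _ hz
  · exact h _ hz

variable [CompleteSpace F]

/-- Each of the two terms in `fderiv_picardStep_sub` contributes at most `K * R * δ * ‖v‖`, so the
defect contracts when `K * R` is small. -/
lemma norm_fderiv_picardStep_sub_le (hA : ContDiff ℝ 1 A) {y x : E} {R K δ : ℝ}
    (hδ : 0 ≤ δ) (hK : ∀ x ∈ Metric.ball y R, ‖A x‖ ≤ K)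
    (hint : ∀ x ∈ Metric.ball y R, IntegrableAt A x)
    (c : F) {w : E → F} (hw : ContDiff ℝ 1 w)
    (h : ∀ x ∈ Metric.ball y R, ∀ v, ‖fderiv ℝ w x v - A x v (w x)‖ ≤ δ * ‖v‖)
    (hx : x ∈ Metric.ball y R) (v : E) :
    ‖fderiv ℝ (picardStep A y c w) x v - A x v (w x)‖ ≤ 2 * (K * R) * δ * ‖v‖ := by
  have hK0 : 0 ≤ K := (norm_nonneg (A x)).trans (hK x hx)
  have hxy : ‖x - y‖ ≤ R := by
    rw [Metric.mem_ball, dist_eq_norm] at hx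
    exact hx.le
  rw [fderiv_picardStep_sub hA hw (fun t ht ↦ hint _ (ray_mem_ball hx ht))]
  refine (intervalIntegral.norm_integral_le_of_norm_le_const (C := 2 * (K * R) * δ * ‖v‖)
    fun t ht ↦ ?_).trans (by simp)
  rw [uIoc_of_le zero_le_one] at ht
  have hz := ray_mem_ball hx (Ioc_subset_Icc_self ht)
  have hb (v v' : E) : ‖A (y + t • (x - y)) v (fderiv ℝ w (y + t • (x - y)) v' -
      A (y + t • (x - y)) v' (w (y + t • (x - y))))‖ ≤ K * ‖v‖ * (δ * ‖v'‖) := by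
    refine ((A _ _).le_opNorm _).trans ?_
    gcongr
    · refine ((A _).le_opNorm _).trans ?_
      gcongr
      exact hK _ hz
    · exact h _ hz _
  rw [norm_smul, Real.norm_of_nonneg ht.1.le]
  refine (mul_le_of_le_one_left (norm_nonneg _) ht.2).trans ((norm_sub_le _ _).trans ?_)
  refine (add_le_add (hb _ _) (hb _ _)).trans ?_
  have h1 : K * ‖x - y‖ * (δ * ‖v‖) ≤ K * R * (δ * ‖v‖) := by gcongr
  linarith

/-- Frobenius theorem for linear total differential equations on a small ball. -/
theorem exists_solution_on_ball (hA : ContDiff ℝ 1 A) {y : E} {R K : ℝ}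
    (hK0 : 0 ≤ K) (hK : ∀ x ∈ Metric.ball y R, ‖A x‖ ≤ K) (hKR : K * R ≤ 1 / 8)
    (hint : ∀ x ∈ Metric.ball y R, IntegrableAt A x) (c : F) :
    ∃ u : E → F, (y ∈ Metric.ball y R → u y = c) ∧
      ∀ x ∈ Metric.ball y R, HasFDerivAt u ((A x).flip (u x)) x := by
  classical
  let W : ℕ → E → F := fun n ↦ (picardStep A y c)^[n] 0
  have hW (n) : W (n + 1) = picardStep A y c (W n) := Function.iterate_succ_apply' _ _ _
  have hWc (n) : ContDiff ℝ 1 (W n) := by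
    induction n with
    | zero => exact contDiff_const
    | succ n ih => rw [hW]; exact contDiff_picardStep hA y c ih
  have hd (n : ℕ) : ∀ x ∈ Metric.ball y R, ‖W (n + 1) x - W n x‖ ≤ ‖c‖ * (1 / 2) ^ n := by
    induction n with
    | zero =>
      intro x _
      simp [W, picardStep]
    | succ n ih =>
      intro x hx
      have := norm_picardStep_sub_le hA (by positivity) hK c (hWc (n + 1)) (hWc n) ih hx
      rw [← hW, ← hW] at this
      refine this.trans ?_
      have h0 : 0 ≤ ‖c‖ * (1 / 2) ^ n := by positivity
      rw [pow_succ]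
      nlinarith
  -- The constant 4 closes the recursion: one step multiplies the old bound by `2 * (K * R) ≤ 1 /
  -- 4`, and replacing `W n` by `W (n + 1)` in the defect adds `K * ‖c‖ * (1 / 2) ^ n`; the total is
  -- half the old bound.
  have hη (n : ℕ) : ∀ x ∈ Metric.ball y R, ∀ v,
      ‖fderiv ℝ (W n) x v - A x v (W n x)‖ ≤ 4 * (K * ‖c‖) * (1 / 2) ^ n * ‖v‖ := by
    induction n with
    | zero =>
      intro x _ v
      have : fderiv ℝ (W 0) x = 0 := by simp [W]
      rw [this]
      simp [W]
      positivity
    | succ n ih =>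
      intro x hx v
      have h1 := norm_fderiv_picardStep_sub_le hA (by positivity) hK hint c (hWc n) ih hx v
      rw [← hW] at h1
      have h2 : ‖A x v (W n x - W (n + 1) x)‖ ≤ K * ‖v‖ * (‖c‖ * (1 / 2) ^ n) := by
        refine ((A _ _).le_opNorm _).trans ?_
        gcongr
        · refine ((A _).le_opNorm _).trans ?_
          gcongr
          exact hK _ hx
        · rw [norm_sub_rev]
          exact hd n x hx
      have h3 : fderiv ℝ (W (n + 1)) x v - A x v (W (n + 1) x) =
          (fderiv ℝ (W (n + 1)) x v - A x v (W n x)) + A x v (W n x - W (n + 1) x) := by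
        rw [(A x v).map_sub]
        abel
      rw [h3]
      refine (norm_add_le _ _).trans ((add_le_add h1 h2).trans ?_)
      have h0 : 0 ≤ K * ‖c‖ * (1 / 2) ^ n * ‖v‖ := by positivity
      rw [pow_succ]
      nlinarith
  have hlim (x : E) : ∃ a, x ∈ Metric.ball y R → Tendsto (W · x) atTop (𝓝 a) := by
    by_cases hx : x ∈ Metric.ball y R
    · obtain ⟨a, ha⟩ := cauchySeq_tendsto_of_complete
        (cauchySeq_of_le_geometric (1 / 2) ‖c‖ (by norm_num) (f := (W · x)) fun n ↦ by
          rw [dist_comm, dist_eq_norm]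
          exact hd n x hx)
      exact ⟨a, fun _ ↦ ha⟩
    · exact ⟨0, fun h ↦ absurd h hx⟩
  choose u hu using hlim
  have hud (n : ℕ) (x) (hx : x ∈ Metric.ball y R) : ‖W n x - u x‖ ≤ 2 * ‖c‖ * (1 / 2) ^ n := by
    have := dist_le_of_le_geometric_of_tendsto (1 / 2) ‖c‖ (by norm_num) (f := (W · x)) (fun n ↦ by
          rw [dist_comm, dist_eq_norm]
          exact hd n x hx) (hu x hx) n
    rw [dist_eq_norm] at this
    refine this.trans (le_of_eq ?_)
    ring
  refine ⟨u, fun hy ↦ ?_, fun x hx ↦ ?_⟩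
  · refine tendsto_nhds_unique (hu y hy) (tendsto_const_nhds.congr' ?_)
    filter_upwards [eventually_ge_atTop 1] with n hn
    obtain ⟨k, rfl⟩ := Nat.exists_eq_add_of_le' hn
    rw [hW]
    simp [picardStep]
  · refine hasFDerivAt_of_tendstoUniformlyOn (f := W) (l := atTop) (f' := fun n ↦ fderiv ℝ (W n))
      (g' := fun x ↦ (A x).flip (u x)) Metric.isOpen_ball ?_
      (fun n x _ ↦ ((hWc n).differentiable one_ne_zero x).hasFDerivAt) hu hx
    rw [Metric.tendstoUniformlyOn_iff]
    intro ε hε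
    -- Here `6 = 4 + 2`: the defect of `W n` from `hη`, and the distance from `W n` to the limit
    -- from `hud`. The derivatives therefore converge uniformly to `A u`.
    have ht : Tendsto (fun n : ℕ ↦ 6 * (K * ‖c‖) * (1 / 2) ^ n) atTop (𝓝 0) := by
      simpa using (tendsto_pow_atTop_nhds_zero_of_lt_one (r := (1 / 2 : ℝ)) (by norm_num)
        (by norm_num)).const_mul (6 * (K * ‖c‖))
    filter_upwards [ht.eventually (gt_mem_nhds hε)] with n hn x hx
    rw [dist_comm, dist_eq_norm]
    refine (ContinuousLinearMap.opNorm_le_bound _ (by positivity) fun v ↦ ?_).trans_lt hn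
    have h2 : ‖A x v (W n x - u x)‖ ≤ K * ‖v‖ * (2 * ‖c‖ * (1 / 2) ^ n) := by
      refine ((A _ _).le_opNorm _).trans ?_
      gcongr
      · refine ((A _).le_opNorm _).trans ?_
        gcongr
        exact hK _ hx
      · exact hud n x hx
    have h3 : (fderiv ℝ (W n) x - (A x).flip (u x)) v =
        (fderiv ℝ (W n) x v - A x v (W n x)) + A x v (W n x - u x) := by
      rw [(A x v).map_sub, sub_apply, ContinuousLinearMap.flip_apply]
      abel
    rw [h3]
    refine (norm_add_le _ _).trans ((add_le_add (hη n x hx v) h2).trans (le_of_eq ?_))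
    ring

end Frobenius

/-! ### Uniqueness, regularity and local existence for the total differential equation -/

section Frobenius

open Set Filter Topology MeasureTheory

variable {E F : Type*} [NormedAddCommGroup E] [NormedSpace ℝ E]
  [NormedAddCommGroup F] [NormedSpace ℝ F] {A : E → E →L[ℝ] F →L[ℝ] F}

/-- Uniqueness for linear total differential equations on convex sets. -/
lemma eq_zero_of_hasFDerivAt {s : Set E} (hs : Convex ℝ s) (hA : ContinuousOn A s) {u : E → F}
    (hu : ∀ x ∈ s, HasFDerivAt u ((A x).flip (u x)) x) {y : E} (hy : y ∈ s) (h0 : u y = 0)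
    {x : E} (hx : x ∈ s) : u x = 0 := by
  set z : ℝ → E := fun t ↦ y + t • (x - y) with hz
  have hzs (t : ℝ) (ht : t ∈ Icc (0 : ℝ) 1) : z t ∈ s := hs.add_smul_sub_mem hy hx ht
  have hzd (t : ℝ) : HasDerivAt z (x - y) t := by
    simpa [hz] using ((hasDerivAt_id t).smul_const (x - y)).const_add y
  have hzc : Continuous z := by fun_prop
  have hud (t : ℝ) (ht : t ∈ Icc (0 : ℝ) 1) :
      HasDerivAt (fun t ↦ u (z t)) (A (z t) (x - y) (u (z t))) t :=
    HasFDerivAt.comp_hasDerivAt (l := u) t (hu _ (hzs t ht)) (hzd t)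
  obtain ⟨C, hC⟩ := isCompact_Icc.exists_bound_of_continuousOn
    ((hA.comp hzc.continuousOn hzs).clm_apply (continuousOn_const (c := x - y)))
  -- On the segment from `y` to `x` the equation becomes a linear ODE, and Grönwall's inequality
  -- applies.
  have := eq_zero_of_abs_deriv_le_mul_abs_self_of_eq_zero_right (f := fun t ↦ u (z t)) (K := C)
    (a := 0) (b := 1) (fun t ht ↦ (hud t ht).continuousAt.continuousWithinAt)
    (fun t ht ↦ (hud t (Ico_subset_Icc_self ht)).hasDerivWithinAt) (by simpa [hz] using h0)
    (fun t ht ↦ ((A _ _).le_opNorm _).trans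
      (mul_le_mul_of_nonneg_right (hC t (Ico_subset_Icc_self ht)) (norm_nonneg _))) 1 (by simp)
  simpa [hz] using this

lemma eqOn_of_hasFDerivAt {s : Set E} (hs : Convex ℝ s) (hA : ContinuousOn A s) {u u' : E → F}
    (hu : ∀ x ∈ s, HasFDerivAt u ((A x).flip (u x)) x)
    (hu' : ∀ x ∈ s, HasFDerivAt u' ((A x).flip (u' x)) x) {y : E} (hy : y ∈ s) (h0 : u y = u' y) :
    EqOn u u' s := by
  intro x hx
  rw [← sub_eq_zero]
  refine eq_zero_of_hasFDerivAt hs hA (u := fun x ↦ u x - u' x) (fun x hx ↦ ?_) hy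
    (sub_eq_zero.2 h0) hx
  rw [map_sub]
  exact (hu x hx).sub (hu' x hx)

-- Bootstrapping: if `u` is of class `Cⁿ`, then so is `Du = A u`, and `u` is of class `Cⁿ⁺¹`.
set_option synthInstance.maxHeartbeats 200000 in
lemma contDiffOn_of_hasFDerivAt [FiniteDimensional ℝ E] {s : Set E} (hs : IsOpen s) (hA : ContDiffOn ℝ ∞ A s) {u : E → F}
    (hu : ∀ x ∈ s, HasFDerivAt u ((A x).flip (u x)) x) : ContDiffOn ℝ ∞ u s := by
  rw [contDiffOn_infty]
  intro n
  induction n with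
  | zero =>
    exact contDiffOn_zero.2 fun x hx ↦ (hu x hx).continuousAt.continuousWithinAt
  | succ n ih =>
    refine (contDiffOn_succ_iff_fderiv_of_isOpen hs).2
      ⟨fun x hx ↦ (hu x hx).differentiableAt.differentiableWithinAt, fun h ↦ absurd h (by exact_mod_cast WithTop.natCast_ne_top n), ?_⟩
    refine ContDiffOn.congr (f := fun x ↦ (A x).flip (u x)) ?_ fun x hx ↦ (hu x hx).fderiv
    refine contDiffOn_clm_apply.2 fun v ↦ ?_
    exact ((contDiffOn_infty.1 hA n).clm_apply contDiffOn_const).clm_apply ih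

/-- The Picard step requires coefficients on the whole space. A bump function extends them without
changing them near `x₀`, so integrability persists on that ball. -/
lemma exists_contDiff_eqOn_ball [FiniteDimensional ℝ E] {G : Type*} [NormedAddCommGroup G]
    [NormedSpace ℝ G] {U : Set E} {A : E → G} (hA : ContDiffOn ℝ 1 A U)
    {x₀ : E} (hx₀ : U ∈ 𝓝 x₀) :
    ∃ ρ > 0, Metric.ball x₀ ρ ⊆ U ∧ ∃ A' : E → G, ContDiff ℝ 1 A' ∧
      EqOn A' A (Metric.ball x₀ ρ) := by
  obtain ⟨ρ, hρ, hρU⟩ := Metric.nhds_basis_closedBall.mem_iff.1 (interior_mem_nhds.2 hx₀)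
  let χ : ContDiffBump x₀ := ⟨ρ / 2, ρ, by positivity, by linarith⟩
  refine ⟨ρ / 2, by positivity, ?_, fun x ↦ χ x • A x, contDiff_iff_contDiffAt.2 fun x ↦ ?_,
    fun x hx ↦ ?_⟩
  · exact (Metric.ball_subset_closedBall.trans (Metric.closedBall_subset_closedBall
      (by linarith))).trans (hρU.trans interior_subset)
  · by_cases hx : x ∈ Metric.closedBall x₀ ρ
    · have : U ∈ 𝓝 x := mem_interior_iff_mem_nhds.1 (hρU hx)
      exact χ.contDiffAt.smul (hA.contDiffAt this)
    · refine contDiffAt_const (c := (0 : G)) |>.congr_of_eventuallyEq ?_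
      filter_upwards [Metric.isClosed_closedBall.isOpen_compl.mem_nhds hx] with z hz
      rw [χ.zero_of_le_dist, zero_smul]
      rw [mem_compl_iff, Metric.mem_closedBall, not_le] at hz
      exact hz.le
  · simp only [χ.one_of_mem_closedBall (Metric.ball_subset_closedBall hx), one_smul]

set_option synthInstance.maxHeartbeats 200000 in
/-- Local Frobenius theorem for linear total differential equations. -/
theorem exists_ball_solutions [FiniteDimensional ℝ E] [CompleteSpace F] {U : Set E}
    (hA : ContDiffOn ℝ 1 A U) (hint : ∀ x ∈ U, IntegrableAt A x) {x₀ : E} (hx₀ : U ∈ 𝓝 x₀) :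
    ∃ r > 0, Metric.ball x₀ r ⊆ U ∧ ∀ y ∈ Metric.ball x₀ r, ∀ c, ∃ u : E → F, u y = c ∧
      ∀ x ∈ Metric.ball x₀ r, HasFDerivAt u ((A x).flip (u x)) x := by
  obtain ⟨ρ, hρ, hρU, A', hA', hAA'⟩ := exists_contDiff_eqOn_ball hA hx₀
  have hint' : ∀ x ∈ Metric.ball x₀ ρ, IntegrableAt A' x := by
    intro x hx v w c
    rw [(hAA'.eventuallyEq_of_mem (Metric.isOpen_ball.mem_nhds hx)).fderiv_eq, hAA' hx]
    exact hint x (hρU hx) v w c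
  have hcn : Continuous fun x ↦ ‖A' x‖ :=
    (continuous_norm (E := E →L[ℝ] F →L[ℝ] F)).comp hA'.continuous
  obtain ⟨K, hK⟩ := (isCompact_closedBall x₀ ρ).bddAbove_image
    (f := fun x ↦ ‖A' x‖) hcn.continuousOn
  rw [mem_upperBounds, forall_mem_image] at hK
  have hK0 : 0 ≤ K := (norm_nonneg (A' x₀)).trans (hK (Metric.mem_closedBall_self hρ.le))
  -- For each `y` in the ball of radius `r` about `x₀`, the ball of radius `2 * r` about `y`
  -- contains that ball and lies in the one of radius `ρ`, as `3 * r ≤ ρ`. The second bound gives `K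
  -- * (2 * r) ≤ 1 / 8`. Solutions thus start at any `y` yet live on one common ball.
  set r := min (ρ / 3) (1 / (16 * (K + 1))) with hr
  have hr0 : 0 < r := by positivity
  have hr1 : r ≤ ρ / 3 := min_le_left _ _
  have hr2 : K * (2 * r) ≤ 1 / 8 := by
    have : r ≤ 1 / (16 * (K + 1)) := min_le_right _ _
    rw [le_div_iff₀ (by positivity)] at this
    nlinarith
  refine ⟨r, hr0, (Metric.ball_subset_ball (by linarith)).trans hρU, fun y hy c ↦ ?_⟩
  have hsub : Metric.ball y (2 * r) ⊆ Metric.ball x₀ ρ :=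
    Metric.ball_subset_ball' (by rw [Metric.mem_ball] at hy; linarith)
  obtain ⟨u, hu0, hu⟩ := exists_solution_on_ball hA' (y := y) (R := 2 * r) hK0
    (fun x hx ↦ hK (Metric.ball_subset_closedBall (hsub hx))) hr2
    (fun x hx ↦ hint' x (hsub hx)) c
  refine ⟨u, hu0 (Metric.mem_ball_self (by positivity)), fun x hx ↦ ?_⟩
  have hx' : x ∈ Metric.ball y (2 * r) := by
    rw [Metric.mem_ball] at hx hy ⊢
    have := dist_triangle_right x y x₀
    linarith
  rw [← hAA' (hsub hx')]
  exact hu x hx'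

end Frobenius

/-! ### Global sections of local systems on simply connected spaces -/

section Monodromy

open Set Filter Topology

variable {X J : Type*} [TopologicalSpace X] [TopologicalSpace J] [DiscreteTopology J]

/-- The bundle with discrete fibre glued from local identifications `T i x` with locally constant
transition functions. -/
def localSystemCore (V : X → Set X) (hV : ∀ i, IsOpen (V i)) (hmem : ∀ i, i ∈ V i)
    (T : X → X → J ≃ J)
    (hT : ∀ i j, ∀ x₀ ∈ V i ∩ V j, ∀ c, ∀ᶠ x in 𝓝 x₀,
      (T j x).symm (T i x c) = (T j x₀).symm (T i x₀ c)) : FiberBundleCore X X J where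
  baseSet := V
  isOpen_baseSet := hV
  indexAt := id
  mem_baseSet_at := hmem
  coordChange i j x c := (T j x).symm (T i x c)
  coordChange_self i x _ v := by simp
  continuousOn_coordChange i j := by
    rintro ⟨x₀, c⟩ ⟨hx₀, -⟩
    refine ContinuousAt.continuousWithinAt ?_
    refine (continuousAt_const (y := (T j x₀).symm (T i x₀ c))).congr ?_
    rw [nhds_prod_eq, nhds_discrete J, EventuallyEq, prod_pure, eventually_map]
    exact (hT i j x₀ hx₀ c).mono fun x hx ↦ hx.symm
  coordChange_comp i j k x _ v := by simp

/-- A local system of sets on a simply connected, locally path connected space has a global section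
with any prescribed value at a point. -/
theorem exists_section_of_localSystem [SimplyConnectedSpace X] [LocallyPathConnectedSpace X]
    (V : X → Set X) (hV : ∀ i, IsOpen (V i)) (hmem : ∀ i, i ∈ V i) (T : X → X → J ≃ J)
    (hT : ∀ i j, ∀ x₀ ∈ V i ∩ V j, ∀ c, ∀ᶠ x in 𝓝 x₀,
      (T j x).symm (T i x c) = (T j x₀).symm (T i x₀ c)) (P : X) (c : J) :
    ∃ s : X → J, s P = c ∧ ∀ i, ∃ d, ∀ᶠ x in 𝓝 i, s x = T i x d := by
  let Z := localSystemCore V hV hmem T hT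
  -- The discrete fibre makes the projection a covering, so the identity of `X` lifts; the lift is
  -- the section.
  have hcov : IsCoveringMap (π J Z.Fiber) := FiberBundle.isCoveringMap (F := J)
  let e₀ : TotalSpace J Z.Fiber := ⟨P, (T P P).symm c⟩
  obtain ⟨F, ⟨hF0, hF⟩, -⟩ := hcov.existsUnique_continuousMap_lifts (ContinuousMap.id X) P e₀ rfl
  have hp (x : X) : (F x).1 = x := congrFun hF x
  -- The fibre over `x` is written in the trivialization indexed by `x` itself; `T x x` turns this
  -- coordinate into a value.
  let val (e : TotalSpace J Z.Fiber) : J := T e.1 e.1 e.2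
  refine ⟨fun x ↦ val (F x), ?_, fun i ↦ ?_⟩
  · change val (F P) = c
    rw [hF0]
    exact (T P P).apply_symm_apply c
  · let e := Z.localTriv i
    -- A continuous coordinate with values in a discrete space is locally constant; its constant
    -- value is the required `d`.
    have hcont : ContinuousAt (fun x ↦ (e (F x)).2) i := by
      refine (continuous_snd.continuousAt).comp (ContinuousAt.comp ?_ F.continuous.continuousAt)
      refine e.continuousAt ?_
      rw [e.mem_source]
      change (F i).1 ∈ V i
      rw [hp]
      exact hmem i
    rw [ContinuousAt, nhds_discrete J, tendsto_pure] at hcont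
    refine ⟨(e (F i)).2, ?_⟩
    filter_upwards [hcont, (hV i).mem_nhds (hmem i)] with x hx hxV
    rw [← hx]
    have key (e' : TotalSpace J Z.Fiber) (he : e'.1 = x) : val e' = T i x (e e').2 := by
      subst he
      exact ((T i e'.1).apply_symm_apply _).symm
    exact key _ (hp x)

end Monodromy

/-! ### Tangent vectors and differentials read in a chart -/

section Coordinates

open Set Filter Topology

variable {m : ℕ} {M : Type*} [TopologicalSpace M]
  [ChartedSpace (EuclideanSpace ℝ (Fin m)) M] [IsManifold (𝓡 m) ∞ M]
  {G : Type*} [NormedAddCommGroup G] [NormedSpace ℝ G]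

/-- The tangent vectors at `q` read in the chart at `x₀`. -/
def chartMap (x₀ q : M) : TangentSpace (𝓡 m) q →L[ℝ] EuclideanSpace ℝ (Fin m) :=
  (trivializationAt (EuclideanSpace ℝ (Fin m)) (TangentSpace (𝓡 m)) x₀).continuousLinearMapAt ℝ q

/-- The tangent vector at `q` with given components in the chart at `x₀`. -/
def chartInv (x₀ q : M) : EuclideanSpace ℝ (Fin m) →L[ℝ] TangentSpace (𝓡 m) q :=
  (trivializationAt (EuclideanSpace ℝ (Fin m)) (TangentSpace (𝓡 m)) x₀).symmL ℝ q

variable {x₀ q : M}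

lemma mem_baseSet (hq : q ∈ (extChartAt (𝓡 m) x₀).source) :
    q ∈ (trivializationAt (EuclideanSpace ℝ (Fin m)) (TangentSpace (𝓡 m)) x₀).baseSet := by
  rwa [TangentBundle.trivializationAt_baseSet, ← extChartAt_source (𝓡 m)]

lemma chartMap_chartInv (hq : q ∈ (extChartAt (𝓡 m) x₀).source)
    (v : EuclideanSpace ℝ (Fin m)) :
    chartMap x₀ q (chartInv x₀ q v) = v :=
  Trivialization.continuousLinearMapAt_symmL _ (mem_baseSet hq) v

lemma chartInv_chartMap (hq : q ∈ (extChartAt (𝓡 m) x₀).source)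
    (v : TangentSpace (𝓡 m) q) :
    chartInv x₀ q (chartMap x₀ q v) = v :=
  Trivialization.symmL_continuousLinearMapAt _ (mem_baseSet hq) v

lemma chartMap_eq_mfderiv (hq : q ∈ (extChartAt (𝓡 m) x₀).source) :
    chartMap x₀ q = mfderiv (𝓡 m) 𝓘(ℝ, EuclideanSpace ℝ (Fin m)) (extChartAt (𝓡 m) x₀) q :=
  TangentBundle.continuousLinearMapAt_trivializationAt (by rwa [← extChartAt_source (𝓡 m)])

lemma chartMap_apply (hq : q ∈ (extChartAt (𝓡 m) x₀).source) (v : TangentSpace (𝓡 m) q) :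
    chartMap x₀ q v =
      (trivializationAt (EuclideanSpace ℝ (Fin m)) (TangentSpace (𝓡 m)) x₀ ⟨q, v⟩).2 := by
  simp [chartMap, Trivialization.coe_linearMapAt_of_mem _ (mem_baseSet hq)]

lemma extChartAt_source_mem_nhds_of_mem (hq : q ∈ (extChartAt (𝓡 m) x₀).source) :
    (extChartAt (𝓡 m) x₀).source ∈ 𝓝 q :=
  (isOpen_extChartAt_source x₀).mem_nhds hq

lemma vfDiffAt_iff (hq : q ∈ (extChartAt (𝓡 m) x₀).source)
    {Y : Π x : M, TangentSpace (𝓡 m) x} :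
    VFDiffAt Y q ↔ MDifferentiableAt (𝓡 m) 𝓘(ℝ, EuclideanSpace ℝ (Fin m))
      (fun x ↦ chartMap x₀ x (Y x)) q := by
  rw [VFDiffAt, Trivialization.mdifferentiableAt_section_iff (𝓡 m)
    (trivializationAt (EuclideanSpace ℝ (Fin m)) (TangentSpace (𝓡 m)) x₀) Y (mem_baseSet hq)]
  refine Filter.EventuallyEq.mdifferentiableAt_iff ?_
  filter_upwards [extChartAt_source_mem_nhds_of_mem hq] with z hz
  rw [chartMap_apply hz]

lemma contMDiffAt_chartMap (hq : q ∈ (extChartAt (𝓡 m) x₀).source) {n : ℕ∞ω} (hn : n ≤ ∞)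
    {Y : Π x : M, TangentSpace (𝓡 m) x} :
    ContMDiffAt (𝓡 m) ((𝓡 m).prod 𝓘(ℝ, EuclideanSpace ℝ (Fin m))) n
      (fun y ↦ (⟨y, Y y⟩ : TangentBundle (𝓡 m) M)) q ↔
    ContMDiffAt (𝓡 m) 𝓘(ℝ, EuclideanSpace ℝ (Fin m)) n (fun x ↦ chartMap x₀ x (Y x)) q := by
  have : ContMDiffVectorBundle n (EuclideanSpace ℝ (Fin m)) (TangentSpace (𝓡 m) : M → Type _)
    (𝓡 m) := ContMDiffVectorBundle.of_le hn
  refine (Trivialization.contMDiffAt_section_iff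
    (trivializationAt (EuclideanSpace ℝ (Fin m)) (TangentSpace (𝓡 m)) x₀)
    (mem_baseSet hq)).trans ?_
  refine Filter.EventuallyEq.contMDiffAt_iff ?_
  filter_upwards [extChartAt_source_mem_nhds_of_mem hq] with z hz
  rw [chartMap_apply hz]

lemma contDiffAt_comp_symm (hq : q ∈ (extChartAt (𝓡 m) x₀).source) {f : M → G} {n : ℕ∞ω}
    (hn : n ≤ ∞) (hf : ContMDiffAt (𝓡 m) 𝓘(ℝ, G) n f q) :
    ContDiffAt ℝ n (f ∘ (extChartAt (𝓡 m) x₀).symm) (extChartAt (𝓡 m) x₀ q) := by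
  rw [← contMDiffAt_iff_contDiffAt]
  have h := ((contMDiffOn_extChartAt_symm (I := 𝓡 m) (n := ∞) x₀).of_le hn).contMDiffAt
    (extChartAt_target_mem_nhds' (I := 𝓡 m) ((extChartAt (𝓡 m) x₀).map_source hq))
  refine ContMDiffAt.comp _ (by rwa [(extChartAt (𝓡 m) x₀).left_inv hq]) h

lemma eventuallyEq_comp_symm_comp (hq : q ∈ (extChartAt (𝓡 m) x₀).source) (f : M → G) :
    f =ᶠ[𝓝 q] (f ∘ (extChartAt (𝓡 m) x₀).symm) ∘ extChartAt (𝓡 m) x₀ := by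
  filter_upwards [extChartAt_source_mem_nhds_of_mem hq] with z hz
  rw [Function.comp_apply, Function.comp_apply, (extChartAt (𝓡 m) x₀).left_inv hz]

lemma mvfderiv_comp_extChartAt (hq : q ∈ (extChartAt (𝓡 m) x₀).source)
    {u : EuclideanSpace ℝ (Fin m) → G} (hu : DifferentiableAt ℝ u (extChartAt (𝓡 m) x₀ q))
    (w : TangentSpace (𝓡 m) q) :
    mvfderiv (𝓡 m) (u ∘ extChartAt (𝓡 m) x₀) q w =
      fderiv ℝ u (extChartAt (𝓡 m) x₀ q) (chartMap x₀ q w) := by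
  have h1 : MDifferentiableAt (𝓡 m) 𝓘(ℝ, EuclideanSpace ℝ (Fin m)) (extChartAt (𝓡 m) x₀) q :=
    mdifferentiableAt_extChartAt (by rwa [← extChartAt_source (𝓡 m)])
  have h2 := mfderiv_comp_apply q hu.mdifferentiableAt h1 w
  rw [mfderiv_eq_fderiv] at h2
  rw [chartMap_eq_mfderiv hq]
  exact h2

lemma mdifferentiableAt_iff_comp_symm (hq : q ∈ (extChartAt (𝓡 m) x₀).source) {f : M → G} :
    MDifferentiableAt (𝓡 m) 𝓘(ℝ, G) f q ↔
      DifferentiableAt ℝ (f ∘ (extChartAt (𝓡 m) x₀).symm) (extChartAt (𝓡 m) x₀ q) := by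
  rw [← mdifferentiableAt_iff_differentiableAt]
  constructor
  · intro hf
    have h := ((contMDiffOn_extChartAt_symm (I := 𝓡 m) (n := ∞) x₀).contMDiffAt
      (extChartAt_target_mem_nhds' (I := 𝓡 m)
        ((extChartAt (𝓡 m) x₀).map_source hq))).mdifferentiableAt (by simp)
    exact MDifferentiableAt.comp _ (by rwa [(extChartAt (𝓡 m) x₀).left_inv hq]) h
  · intro hf
    refine MDifferentiableAt.congr_of_eventuallyEq ?_ (eventuallyEq_comp_symm_comp hq f)
    exact hf.comp q (mdifferentiableAt_extChartAt (by rwa [← extChartAt_source (𝓡 m)]))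

lemma mvfderiv_eq_fderiv_comp_symm (hq : q ∈ (extChartAt (𝓡 m) x₀).source) {f : M → G}
    (hf : MDifferentiableAt (𝓡 m) 𝓘(ℝ, G) f q) (w : TangentSpace (𝓡 m) q) :
    mvfderiv (𝓡 m) f q w = fderiv ℝ (f ∘ (extChartAt (𝓡 m) x₀).symm) (extChartAt (𝓡 m) x₀ q)
      (chartMap x₀ q w) := by
  rw [← mvfderiv_comp_extChartAt hq ((mdifferentiableAt_iff_comp_symm hq).1 hf)]
  have := (eventuallyEq_comp_symm_comp (m := m) hq f).mfderiv_eq (I := 𝓡 m) (I' := 𝓘(ℝ, G))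
  simp only [mvfderiv, this]
  congr 2

lemma mvfderiv_congr {f f' : M → G} (h : f =ᶠ[𝓝 q] f') :
    mvfderiv (𝓡 m) f q = mvfderiv (𝓡 m) f' q := by
  have := h.mfderiv_eq (I := 𝓡 m) (I' := 𝓘(ℝ, G))
  ext w
  exact congrArg (· w) this

lemma mvfderiv_clm_comp {G' : Type*} [NormedAddCommGroup G'] [NormedSpace ℝ G'] (L : G →L[ℝ] G')
    {f : M → G} (hf : MDifferentiableAt (𝓡 m) 𝓘(ℝ, G) f q) (w : TangentSpace (𝓡 m) q) :
    mvfderiv (𝓡 m) (fun x ↦ L (f x)) q w = L (mvfderiv (𝓡 m) f q w) := by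
  have h := mfderiv_comp_apply q (L.differentiableAt (x := f q)).mdifferentiableAt hf w
  rw [mfderiv_eq_fderiv, L.fderiv] at h
  exact h

end Coordinates

/-! ### Coordinate vector fields and Christoffel symbols -/

section Frame

open Set Filter Topology

variable {m : ℕ} {M : Type*} [TopologicalSpace M] [T2Space M]
  [ChartedSpace (EuclideanSpace ℝ (Fin m)) M] [IsManifold (𝓡 m) ∞ M]
  {G : Type*} [NormedAddCommGroup G] [NormedSpace ℝ G]

lemma contMDiffOn_chartInv (x₀ : M) (v : EuclideanSpace ℝ (Fin m)) :
    ContMDiffOn (𝓡 m) ((𝓡 m).prod 𝓘(ℝ, EuclideanSpace ℝ (Fin m))) ∞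
      (fun y ↦ (⟨y, chartInv x₀ y v⟩ : TangentBundle (𝓡 m) M)) (extChartAt (𝓡 m) x₀).source := by
  intro q hq
  refine ((contMDiffAt_chartMap hq le_rfl).2 ?_).contMDiffWithinAt
  refine (contMDiffAt_const (c := v)).congr_of_eventuallyEq ?_
  filter_upwards [extChartAt_source_mem_nhds_of_mem hq] with z hz
  rw [chartMap_chartInv hz]

/-- A smooth bump function around `x₀`. -/
def chartBump (x₀ : M) : SmoothBumpFunction (𝓡 m) x₀ := Classical.arbitrary _

/-- A smooth global vector field which near `x₀` has constant components `v` in the chart. -/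
def coordField (x₀ : M) (v : EuclideanSpace ℝ (Fin m)) : SmoothVF m M where
  toFun q := chartBump (m := m) x₀ q • chartInv x₀ q v
  contMDiff_toFun :=
    ContMDiffOn.smul_section_of_tsupport ((chartBump (m := m) x₀).contMDiff.contMDiffOn)
      (isOpen_extChartAt_source x₀) (chartBump (m := m) x₀).tsupport_subset_extChartAt_source
      (contMDiffOn_chartInv x₀ v)

/-- The neighbourhood of `x₀` on which `coordField x₀` is the coordinate frame. -/
def coordNhd (m : ℕ) {M : Type*} [TopologicalSpace M] [T2Space M]
    [ChartedSpace (EuclideanSpace ℝ (Fin m)) M] [IsManifold (𝓡 m) ∞ M] (x₀ : M) : Set M :=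
  (extChartAt (𝓡 m) x₀).source ∩
    extChartAt (𝓡 m) x₀ ⁻¹' Metric.ball (extChartAt (𝓡 m) x₀ x₀) (chartBump (m := m) x₀).rIn

variable {x₀ q : M}

lemma isOpen_coordNhd (x₀ : M) : IsOpen (coordNhd m x₀) := by
  rw [coordNhd, extChartAt_source]
  exact isOpen_extChartAt_preimage x₀ Metric.isOpen_ball

lemma mem_coordNhd (x₀ : M) : x₀ ∈ coordNhd m x₀ :=
  ⟨mem_extChartAt_source x₀, Metric.mem_ball_self (chartBump (m := m) x₀).rIn_pos⟩

lemma coordField_apply (hq : q ∈ coordNhd m x₀) (v : EuclideanSpace ℝ (Fin m)) :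
    coordField x₀ v q = chartInv x₀ q v := by
  change chartBump (m := m) x₀ q • chartInv x₀ q v = _
  rw [(chartBump (m := m) x₀).one_of_dist_le (by rw [← extChartAt_source (𝓡 m)]; exact hq.1)
    (Metric.mem_ball.1 hq.2).le, one_smul]

lemma chartMap_coordField (hq : q ∈ coordNhd m x₀) (v : EuclideanSpace ℝ (Fin m)) :
    chartMap x₀ q (coordField x₀ v q) = v := by
  rw [coordField_apply hq, chartMap_chartInv hq.1]

/-- Every tangent vector is the value of a smooth global vector field. -/
lemma exists_smoothVF_apply_eq (x : M) (v : TangentSpace (𝓡 m) x) :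
    ∃ X : SmoothVF m M, X x = v :=
  ⟨coordField x (chartMap x x v), by
    rw [coordField_apply (mem_coordNhd x), chartInv_chartMap (mem_extChartAt_source x)]⟩

lemma SmoothVF.vfDiffAt (X : SmoothVF m M) (x : M) : VFDiffAt X x :=
  (X.contMDiff x).mdifferentiableAt (by simp)

/-- The Christoffel symbols of `A` in the chart at `x₀`: `christoffel A x₀ q w v` are the components
of `∇_v W` at `q`, where `W` has constant components `w`. -/
def christoffel (A : AffineStructure m M) (x₀ q : M) :
    EuclideanSpace ℝ (Fin m) →L[ℝ] EuclideanSpace ℝ (Fin m) →L[ℝ] EuclideanSpace ℝ (Fin m) :=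
  ∑ k, (EuclideanSpace.proj k : EuclideanSpace ℝ (Fin m) →L[ℝ] ℝ).smulRight
    (chartMap x₀ q ∘L A.conn (coordField x₀ (EuclideanSpace.single k 1)) q ∘L chartInv x₀ q)

lemma christoffel_apply (A : AffineStructure m M) (x₀ q : M) (w v : EuclideanSpace ℝ (Fin m)) :
    christoffel A x₀ q w v = ∑ k, w k •
      chartMap x₀ q (A.conn (coordField x₀ (EuclideanSpace.single k 1)) q (chartInv x₀ q v)) := by
  simp [christoffel]

lemma eventuallyEq_sum_coordField (hq : q ∈ coordNhd m x₀) (Y : Π x : M, TangentSpace (𝓡 m) x) :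
    ∀ᶠ x in 𝓝 q, Y x = ∑ k : Fin m, chartMap x₀ x (Y x) k •
      coordField x₀ (EuclideanSpace.single k 1) x := by
  filter_upwards [(isOpen_coordNhd x₀).mem_nhds hq] with x hx
  conv_lhs => rw [← chartInv_chartMap hx.1 (Y x)]
  conv_lhs => rw [← (EuclideanSpace.basisFun (Fin m) ℝ).sum_repr (chartMap x₀ x (Y x))]
  rw [map_sum]
  simp [coordField_apply hx]

lemma conn_sum (D : TangentConnection m M) {ι : Type*} (s : Finset ι)
    {σ : ι → Π x : M, TangentSpace (𝓡 m) x} (hσ : ∀ i ∈ s, VFDiffAt (σ i) q) :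
    D (fun x ↦ ∑ i ∈ s, σ i x) q = ∑ i ∈ s, D (σ i) q := by
  classical
  induction s using Finset.induction_on with
  | empty => exact congrFun D.zero q
  | insert a s ha ih =>
    simp only [Finset.mem_insert, forall_eq_or_imp] at hσ
    simp only [Finset.sum_insert ha, ← ih hσ.2]
    exact D.isCovariantDerivativeOnUniv.add hσ.1 (.sum_section hσ.2)

/-- The covariant derivative in coordinates. -/
lemma chartMap_conn (A : AffineStructure m M) (hq : q ∈ coordNhd m x₀)
    {Y : Π x : M, TangentSpace (𝓡 m) x} (hY : VFDiffAt Y q) (w : TangentSpace (𝓡 m) q) :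
    chartMap x₀ q (A.conn Y q w) =
      mvfderiv (𝓡 m) (fun x ↦ chartMap x₀ x (Y x)) q w +
        christoffel A x₀ q (chartMap x₀ q (Y q)) (chartMap x₀ q w) := by
  have hY' := (vfDiffAt_iff hq.1).1 hY
  have hk (k : Fin m) : MDifferentiableAt (𝓡 m) 𝓘(ℝ, ℝ) (fun x ↦ chartMap x₀ x (Y x) k) q :=
    (EuclideanSpace.proj k :
      EuclideanSpace ℝ (Fin m) →L[ℝ] ℝ).differentiableAt.comp_mdifferentiableAt hY'
  have hX (k : Fin m) := (coordField (m := m) x₀ (EuclideanSpace.single k 1)).vfDiffAt q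
  have hkX (k : Fin m) : VFDiffAt ((fun x ↦ chartMap x₀ x (Y x) k) •
      (coordField (m := m) x₀ (EuclideanSpace.single k 1) : Π x : M, TangentSpace (𝓡 m) x)) q :=
    (hk k).smul_section (hX k)
  -- The expansion of `Y` in the frame holds only near `q`; locality of the connection suffices.
  have h1 := A.conn.isCovariantDerivativeOnUniv.congr_of_eventuallyEq hY
    (.sum_section fun k _ ↦ hkX k) univ_mem (eventuallyEq_sum_coordField hq Y)
  have h2 : A.conn Y q = _ := h1.trans (conn_sum A.conn Finset.univ fun k _ ↦ hkX k)
  have h3 (k : Fin m) := A.conn.isCovariantDerivativeOnUniv.leibniz (hX k) (hk k)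
  rw [h2, christoffel_apply, chartInv_chartMap hq.1, sum_apply, map_sum]
  have h4 : mvfderiv (𝓡 m) (fun x ↦ chartMap x₀ x (Y x)) q w = ∑ k,
      mvfderiv (𝓡 m) (fun x ↦ chartMap x₀ x (Y x) k) q w • EuclideanSpace.single k (1 : ℝ) := by
    conv_lhs => rw [← (EuclideanSpace.basisFun (Fin m) ℝ).sum_repr
      (mvfderiv (𝓡 m) (fun x ↦ chartMap x₀ x (Y x)) q w)]
    refine Finset.sum_congr rfl fun k _ ↦ ?_
    rw [EuclideanSpace.basisFun_apply, EuclideanSpace.basisFun_repr]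
    exact congrArg (· • EuclideanSpace.single k (1 : ℝ)) (mvfderiv_clm_comp
      (EuclideanSpace.proj k : EuclideanSpace ℝ (Fin m) →L[ℝ] ℝ) hY' w).symm
  rw [h4, ← Finset.sum_add_distrib]
  refine Finset.sum_congr rfl fun k _ ↦ ?_
  rw [h3]
  simp only [add_apply, smul_apply, ContinuousLinearMap.smulRight_apply, map_add, map_smul,
    chartMap_coordField hq]
  exact add_comm _ _

end Frame

/-! ### Torsion, curvature and Hessian in coordinates -/

section CoordinateFormulas

open Set Filter Topology

variable {m : ℕ} {M : Type*} [TopologicalSpace M] [T2Space M]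
  [ChartedSpace (EuclideanSpace ℝ (Fin m)) M] [IsManifold (𝓡 m) ∞ M]
  {G : Type*} [NormedAddCommGroup G] [NormedSpace ℝ G] {x₀ q : M}

lemma AffineStructure.contMDiff_conn (A : AffineStructure m M) (X Y : SmoothVF m M) :
    ContMDiff (𝓡 m) ((𝓡 m).prod 𝓘(ℝ, EuclideanSpace ℝ (Fin m))) ∞
      (fun y ↦ (⟨y, A.conn Y y (X y)⟩ : TangentBundle (𝓡 m) M)) := by
  intro x
  have hY := A.smooth.contMDiff.contMDiff (σ := fun x ↦ Y x) (by
    simpa using! Y.contMDiff.contMDiffOn)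
  exact ContMDiffAt.clm_bundle_apply (hY.contMDiffAt Filter.univ_mem) (X.contMDiff x)

lemma eventually_chartMap_coordField (hq : q ∈ coordNhd m x₀) (v : EuclideanSpace ℝ (Fin m)) :
    (fun x ↦ chartMap x₀ x (coordField x₀ v x)) =ᶠ[𝓝 q] fun _ ↦ v := by
  filter_upwards [(isOpen_coordNhd x₀).mem_nhds hq] with x hx
  exact chartMap_coordField hx v

lemma christoffel_eq (A : AffineStructure m M) (hq : q ∈ coordNhd m x₀)
    (w v : EuclideanSpace ℝ (Fin m)) :
    christoffel A x₀ q w v =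
      chartMap x₀ q (A.conn (coordField x₀ w) q (coordField x₀ v q)) := by
  rw [chartMap_conn A hq ((coordField x₀ w).vfDiffAt q),
    mvfderiv_congr (eventually_chartMap_coordField hq w), mvfderiv_const, chartMap_coordField hq,
    chartMap_coordField hq]
  simp

/-- Near `q` both fields are pullbacks by the chart of constant fields, and pullback commutes with
the bracket. -/
lemma mlieBracket_coordField (hq : q ∈ coordNhd m x₀) (v w : EuclideanSpace ℝ (Fin m)) :
    mlieBracket (𝓡 m) (coordField x₀ v) (coordField x₀ w) q = 0 := by
  have : IsManifold (𝓡 m) (minSmoothness ℝ 2) M := IsManifold.of_le (n := ∞) (by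
    rw [minSmoothness_of_isRCLikeNormedField]; exact ENat.LEInfty.out)
  let V (v : EuclideanSpace ℝ (Fin m)) (p : EuclideanSpace ℝ (Fin m)) :
    TangentSpace 𝓘(ℝ, EuclideanSpace ℝ (Fin m)) p := v
  have h (v : EuclideanSpace ℝ (Fin m)) : (coordField x₀ v : Π x : M, TangentSpace (𝓡 m) x) =ᶠ[𝓝 q]
      mpullback (𝓡 m) 𝓘(ℝ, EuclideanSpace ℝ (Fin m)) (extChartAt (𝓡 m) x₀) (V v) := by
    filter_upwards [(isOpen_coordNhd x₀).mem_nhds hq] with x hx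
    rw [mpullback_apply, ← chartMap_eq_mfderiv hx.1, coordField_apply hx]
    exact congrArg (fun L : EuclideanSpace ℝ (Fin m) →L[ℝ] TangentSpace (𝓡 m) x ↦ L v)
      (ContinuousLinearMap.inverse_eq (f := chartMap x₀ x) (g := chartInv x₀ x)
        (ContinuousLinearMap.ext (chartMap_chartInv hx.1))
        (ContinuousLinearMap.ext (chartInv_chartMap hx.1))).symm
  have hd (v : EuclideanSpace ℝ (Fin m)) : MDifferentiableAt 𝓘(ℝ, EuclideanSpace ℝ (Fin m))
      (𝓘(ℝ, EuclideanSpace ℝ (Fin m)).prod 𝓘(ℝ, EuclideanSpace ℝ (Fin m)))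
      (fun y ↦ (⟨y, V v y⟩ : TangentBundle 𝓘(ℝ, EuclideanSpace ℝ (Fin m))
        (EuclideanSpace ℝ (Fin m)))) (extChartAt (𝓡 m) x₀ q) := by
    have := (contMDiff_vectorSpace_iff_contDiff (n := 1) (V := V v)).2 contDiff_const
    exact (this _).mdifferentiableAt one_ne_zero
  rw [(h v).mlieBracket_vectorField_eq (h w),
    ← mpullback_mlieBracket (n := ∞) (hd v) (hd w)
      (contMDiffAt_extChartAt' (by rw [← extChartAt_source (𝓡 m)]; exact hq.1))
      (by rw [minSmoothness_of_isRCLikeNormedField]; exact ENat.LEInfty.out),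
    mpullback_apply, ← mlieBracketWithin_univ, mlieBracketWithin_eq_lieBracketWithin,
    lieBracketWithin_univ]
  have h0 : lieBracket ℝ (V v) (V w) (extChartAt (𝓡 m) x₀ q) = 0 := by
    simp [lieBracket, V]
  rw [h0]
  exact map_zero (mfderiv (𝓡 m) 𝓘(ℝ, EuclideanSpace ℝ (Fin m)) (extChartAt (𝓡 m) x₀) q).inverse

lemma christoffel_symm (A : AffineStructure m M) (hq : q ∈ coordNhd m x₀)
    (w v : EuclideanSpace ℝ (Fin m)) :
    christoffel A x₀ q w v = christoffel A x₀ q v w := by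
  have h := (CovariantDerivative.torsion_eq_zero_iff A.conn).1 A.torsion_free
    ((coordField x₀ v).vfDiffAt q) ((coordField x₀ w).vfDiffAt q)
  rw [mlieBracket_coordField hq, sub_eq_zero] at h
  rw [christoffel_eq A hq, christoffel_eq A hq, h]

/-- The image of `coordNhd m x₀` in the chart. -/
def coordDomain (m : ℕ) {M : Type*} [TopologicalSpace M] [T2Space M]
    [ChartedSpace (EuclideanSpace ℝ (Fin m)) M] [IsManifold (𝓡 m) ∞ M] (x₀ : M) :
    Set (EuclideanSpace ℝ (Fin m)) :=
  (extChartAt (𝓡 m) x₀).target ∩ (extChartAt (𝓡 m) x₀).symm ⁻¹' coordNhd m x₀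

lemma isOpen_coordDomain (x₀ : M) : IsOpen (coordDomain m x₀) :=
  (continuousOn_extChartAt_symm x₀).isOpen_inter_preimage (isOpen_extChartAt_target x₀)
    (isOpen_coordNhd x₀)

lemma extChartAt_mem_coordDomain (hq : q ∈ coordNhd m x₀) :
    extChartAt (𝓡 m) x₀ q ∈ coordDomain m x₀ :=
  ⟨(extChartAt (𝓡 m) x₀).map_source hq.1, by
    rwa [mem_preimage, (extChartAt (𝓡 m) x₀).left_inv hq.1]⟩

/-- The Christoffel symbols as functions on the chart domain. -/
def christoffelChart (A : AffineStructure m M) (x₀ : M) (p : EuclideanSpace ℝ (Fin m)) :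
    EuclideanSpace ℝ (Fin m) →L[ℝ] EuclideanSpace ℝ (Fin m) →L[ℝ] EuclideanSpace ℝ (Fin m) :=
  christoffel A x₀ ((extChartAt (𝓡 m) x₀).symm p)

lemma contDiffOn_christoffelChart (A : AffineStructure m M) (x₀ : M) :
    ContDiffOn ℝ ∞ (christoffelChart A x₀) (coordDomain m x₀) := by
  refine contDiffOn_clm_apply.2 fun w ↦ contDiffOn_clm_apply.2 fun v ↦ ?_
  intro p hp
  set q := (extChartAt (𝓡 m) x₀).symm p with hqp
  have hq : q ∈ coordNhd m x₀ := hp.2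
  have h := (contMDiffAt_chartMap hq.1 le_rfl).1
    (A.contMDiff_conn (coordField x₀ v) (coordField x₀ w) q)
  have h2 := contDiffAt_comp_symm hq.1 le_rfl h
  rw [hqp, (extChartAt (𝓡 m) x₀).right_inv hp.1] at h2
  refine (h2.congr_of_eventuallyEq ?_).contDiffWithinAt
  filter_upwards [(isOpen_coordDomain x₀).mem_nhds hp] with p' hp'
  exact christoffel_eq A hp'.2 w v

/-- Vanishing of the curvature in coordinates. -/
lemma curvature_christoffelChart {A : AffineStructure m M} (hA : IsFlat A.conn)
    {p : EuclideanSpace ℝ (Fin m)} (hp : p ∈ coordDomain m x₀)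
    (v w z : EuclideanSpace ℝ (Fin m)) :
    fderiv ℝ (christoffelChart A x₀) p v z w +
        christoffelChart A x₀ p (christoffelChart A x₀ p z w) v =
      fderiv ℝ (christoffelChart A x₀) p w z v +
        christoffelChart A x₀ p (christoffelChart A x₀ p z v) w := by
  set q := (extChartAt (𝓡 m) x₀).symm p with hqp
  have hq : q ∈ coordNhd m x₀ := hp.2
  have hφq : extChartAt (𝓡 m) x₀ q = p := (extChartAt (𝓡 m) x₀).right_inv hp.1
  have hΓ : DifferentiableAt ℝ (christoffelChart A x₀) p :=
    ((contDiffOn_christoffelChart A x₀).contDiffAt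
      ((isOpen_coordDomain x₀).mem_nhds hp)).differentiableAt (by simp)
  -- Coordinate fields have vanishing bracket, so the curvature is the antisymmetrization of this
  -- second covariant derivative in `v` and `w`.
  have key (v w : EuclideanSpace ℝ (Fin m)) :
      chartMap x₀ q (A.conn (fun x ↦ A.conn (coordField x₀ z) x (coordField x₀ w x)) q
        (coordField x₀ v q)) = fderiv ℝ (christoffelChart A x₀) p v z w +
        christoffelChart A x₀ p (christoffelChart A x₀ p z w) v := by
    rw [chartMap_conn A hq (A.mdifferentiableAt_conn _ ((coordField x₀ w).vfDiffAt q)),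
      ← christoffel_eq A hq, chartMap_coordField hq]
    congr 1
    have h : (fun x ↦ chartMap x₀ x (A.conn (coordField x₀ z) x (coordField x₀ w x))) =ᶠ[𝓝 q]
        (fun p ↦ christoffelChart A x₀ p z w) ∘ extChartAt (𝓡 m) x₀ := by
      filter_upwards [(isOpen_coordNhd x₀).mem_nhds hq] with x hx
      rw [← christoffel_eq A hx, Function.comp_apply, christoffelChart,
        (extChartAt (𝓡 m) x₀).left_inv hx.1]
    have hd : HasFDerivAt (fun p ↦ christoffelChart A x₀ p z w) _ p :=
      (hΓ.hasFDerivAt.clm_apply (hasFDerivAt_const z p)).clm_apply (hasFDerivAt_const w p)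
    rw [mvfderiv_congr h, mvfderiv_comp_extChartAt hq.1 (by rw [hφq]; exact hd.differentiableAt),
      hφq, hd.fderiv, chartMap_coordField hq]
    simp
  have hcurv := hA (coordField x₀ v) (coordField x₀ w) (coordField x₀ z) q
  rw [curvature, mlieBracket_coordField hq, map_zero, sub_zero, sub_eq_zero] at hcurv
  rw [← key v w, ← key w v, hcurv]

/-- The derivative of a function along a vector field, in coordinates. -/
lemma mvfderiv_apply_eventuallyEq (hq : q ∈ coordNhd m x₀) {f : M → ℝ}
    (hf : ContMDiffAt (𝓡 m) 𝓘(ℝ, ℝ) ∞ f q) (Y : Π x : M, TangentSpace (𝓡 m) x) :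
    (fun x ↦ mvfderiv (𝓡 m) f x (Y x)) =ᶠ[𝓝 q]
      (fun p ↦ fderiv ℝ (f ∘ (extChartAt (𝓡 m) x₀).symm) p
        (((fun x ↦ chartMap x₀ x (Y x)) ∘ (extChartAt (𝓡 m) x₀).symm) p)) ∘
          extChartAt (𝓡 m) x₀ := by
  -- Regularity of order `∞` at a single point need not spread to a neighbourhood, while finite
  -- order does; order 1 is enough.
  have hfev : ∀ᶠ x in 𝓝 q, MDifferentiableAt (𝓡 m) 𝓘(ℝ, ℝ) f x :=
    ((contMDiffAt_iff_contMDiffAt_nhds (by simp)).1 (hf.of_le (m := 1) ENat.LEInfty.out)).mono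
      fun x hx ↦ hx.mdifferentiableAt one_ne_zero
  filter_upwards [(isOpen_coordNhd x₀).mem_nhds hq, hfev] with x hx hfx
  rw [mvfderiv_eq_fderiv_comp_symm hx.1 hfx, Function.comp_apply, Function.comp_apply,
    (extChartAt (𝓡 m) x₀).left_inv hx.1]

/-- The Hessian in coordinates. -/
lemma hessian_eq (A : AffineStructure m M) (hq : q ∈ coordNhd m x₀) {f : M → ℝ}
    (hf : ContMDiffAt (𝓡 m) 𝓘(ℝ, ℝ) ∞ f q) (X Y : SmoothVF m M) :
    A.hessian f X Y q =
      fderiv ℝ (fderiv ℝ (f ∘ (extChartAt (𝓡 m) x₀).symm)) (extChartAt (𝓡 m) x₀ q)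
        (chartMap x₀ q (X q)) (chartMap x₀ q (Y q)) -
      fderiv ℝ (f ∘ (extChartAt (𝓡 m) x₀).symm) (extChartAt (𝓡 m) x₀ q)
        (christoffel A x₀ q (chartMap x₀ q (Y q)) (chartMap x₀ q (X q))) := by
  have hfd : MDifferentiableAt (𝓡 m) 𝓘(ℝ, ℝ) f q := hf.mdifferentiableAt (by simp)
  set F := f ∘ (extChartAt (𝓡 m) x₀).symm with hF
  set p := extChartAt (𝓡 m) x₀ q with hp
  have hFc : ContDiffAt ℝ ∞ F p := contDiffAt_comp_symm hq.1 le_rfl hf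
  have hF' : DifferentiableAt ℝ (fderiv ℝ F) p :=
    (hFc.fderiv_right (m := 1) (by rw [one_add_one_eq_two]; exact ENat.LEInfty.out)).differentiableAt one_ne_zero
  have hY := (vfDiffAt_iff hq.1).1 (Y.vfDiffAt q)
  have hYE := (mdifferentiableAt_iff_comp_symm hq.1).1 hY
  have h1 := mvfderiv_apply_eventuallyEq hq hf Y
  have hd := hF'.hasFDerivAt.clm_apply hYE.hasFDerivAt
  rw [AffineStructure.hessian, mvfderiv_congr h1, mvfderiv_comp_extChartAt hq.1 hd.differentiableAt,
    hd.fderiv, mvfderiv_eq_fderiv_comp_symm hq.1 hfd, chartMap_conn A hq (Y.vfDiffAt q),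
    mvfderiv_eq_fderiv_comp_symm hq.1 hY, map_add]
  have hYq : ((fun x ↦ chartMap x₀ x (Y x)) ∘ (extChartAt (𝓡 m) x₀).symm) p =
      chartMap x₀ q (Y q) := by
    rw [Function.comp_apply, hp, (extChartAt (𝓡 m) x₀).left_inv hq.1]
  simp only [add_apply, ContinuousLinearMap.comp_apply, ContinuousLinearMap.flip_apply, hYq,
    ← hp, ← hF]
  ring

lemma mdifferentiableAt_mvfderiv_apply {f : M → ℝ} (hf : ContMDiffAt (𝓡 m) 𝓘(ℝ, ℝ) ∞ f q)
    {Y : Π x : M, TangentSpace (𝓡 m) x} (hY : VFDiffAt Y q) :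
    MDifferentiableAt (𝓡 m) 𝓘(ℝ, ℝ) (fun x ↦ mvfderiv (𝓡 m) f x (Y x)) q := by
  have hq := mem_coordNhd (m := m) q
  have hF' := ((contDiffAt_comp_symm hq.1 le_rfl hf).fderiv_right (m := 1)
    (by rw [one_add_one_eq_two]; exact ENat.LEInfty.out)).differentiableAt one_ne_zero
  have hYE := (mdifferentiableAt_iff_comp_symm hq.1).1 ((vfDiffAt_iff hq.1).1 hY)
  refine MDifferentiableAt.congr_of_eventuallyEq ?_ (mvfderiv_apply_eventuallyEq hq hf Y)
  exact (hF'.clm_apply hYE).comp_mdifferentiableAt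
    (mdifferentiableAt_extChartAt (mem_chart_source _ q))

lemma AffineStructure.hessian_symm (A : AffineStructure m M) {f : M → ℝ}
    (hf : ContMDiffAt (𝓡 m) 𝓘(ℝ, ℝ) ∞ f q) (X Y : SmoothVF m M) :
    A.hessian f X Y q = A.hessian f Y X q := by
  have hq := mem_coordNhd (m := m) q
  have hsymm : IsSymmSndFDerivAt ℝ (f ∘ (extChartAt (𝓡 m) q).symm) (extChartAt (𝓡 m) q q) :=
    (contDiffAt_comp_symm hq.1 le_rfl hf).isSymmSndFDerivAt
      (by rw [minSmoothness_of_isRCLikeNormedField]; exact ENat.LEInfty.out)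
  rw [hessian_eq A hq hf, hessian_eq A hq hf, hsymm, christoffel_symm A hq]

end CoordinateFormulas

/-! ### Affine functions as solutions of a linear system for their jets -/

section LocalAffineFunctions

open Set Filter Topology

variable {m : ℕ} {M : Type*} [TopologicalSpace M] [T2Space M]
  [ChartedSpace (EuclideanSpace ℝ (Fin m)) M] [IsManifold (𝓡 m) ∞ M] {x₀ q : M}

/-- First order jets of functions on `ℝ^m`: a value and a differential. -/
def Jet (m : ℕ) : Type := ℝ × (EuclideanSpace ℝ (Fin m) →L[ℝ] ℝ)

namespace Jet

instance : NormedAddCommGroup (Jet m) :=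
  inferInstanceAs (NormedAddCommGroup (ℝ × (EuclideanSpace ℝ (Fin m) →L[ℝ] ℝ)))

instance : NormedSpace ℝ (Jet m) :=
  inferInstanceAs (NormedSpace ℝ (ℝ × (EuclideanSpace ℝ (Fin m) →L[ℝ] ℝ)))

instance : FiniteDimensional ℝ (Jet m) :=
  inferInstanceAs (FiniteDimensional ℝ (ℝ × (EuclideanSpace ℝ (Fin m) →L[ℝ] ℝ)))

instance : CompleteSpace (Jet m) := FiniteDimensional.complete ℝ _

/-- The jet with value `a` and differential `α`. -/
def mk (a : ℝ) (α : EuclideanSpace ℝ (Fin m) →L[ℝ] ℝ) : Jet m := (a, α)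

/-- The value of a jet. -/
def val : Jet m →L[ℝ] ℝ := ContinuousLinearMap.fst ℝ ℝ (EuclideanSpace ℝ (Fin m) →L[ℝ] ℝ)

/-- The differential of a jet. -/
def diff : Jet m →L[ℝ] EuclideanSpace ℝ (Fin m) →L[ℝ] ℝ :=
  ContinuousLinearMap.snd ℝ ℝ (EuclideanSpace ℝ (Fin m) →L[ℝ] ℝ)

@[simp] lemma val_mk (a : ℝ) (α : EuclideanSpace ℝ (Fin m) →L[ℝ] ℝ) : val (mk a α) = a := rfl

@[simp] lemma diff_mk (a : ℝ) (α : EuclideanSpace ℝ (Fin m) →L[ℝ] ℝ) : diff (mk a α) = α := rfl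

lemma ext {c d : Jet m} (h : val c = val d) (h' : diff c = diff d) : c = d := Prod.ext h h'

/-- The linear map `(a, α) ↦ (α v, w ↦ α (Γ w v))`. -/
def coeffAux (Γ : EuclideanSpace ℝ (Fin m) →L[ℝ] EuclideanSpace ℝ (Fin m) →L[ℝ]
    EuclideanSpace ℝ (Fin m)) (v : EuclideanSpace ℝ (Fin m)) : Jet m →ₗ[ℝ] Jet m where
  toFun c := mk (diff c v) (diff c ∘L Γ.flip v)
  map_add' c d := ext (by simp) (by simp [ContinuousLinearMap.add_comp])
  map_smul' a c := ext (by simp) (by simp [ContinuousLinearMap.smul_comp])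

/-- The coefficients of the first order system satisfied by the jets of affine functions. -/
def coeff (Γ : EuclideanSpace ℝ (Fin m) →L[ℝ] EuclideanSpace ℝ (Fin m) →L[ℝ]
    EuclideanSpace ℝ (Fin m)) : EuclideanSpace ℝ (Fin m) →L[ℝ] Jet m →L[ℝ] Jet m :=
  LinearMap.toContinuousLinearMap
    { toFun v := LinearMap.toContinuousLinearMap (coeffAux Γ v)
      map_add' v w := ContinuousLinearMap.ext fun c ↦
        ext (by simp [coeffAux]) (by simp [coeffAux, ContinuousLinearMap.comp_add])
      map_smul' a v := ContinuousLinearMap.ext fun c ↦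
        ext (by simp [coeffAux]) (by simp [coeffAux]) }

lemma coeff_apply (Γ : EuclideanSpace ℝ (Fin m) →L[ℝ] EuclideanSpace ℝ (Fin m) →L[ℝ]
    EuclideanSpace ℝ (Fin m)) (v : EuclideanSpace ℝ (Fin m)) (c : Jet m) :
    coeff Γ v c = mk (diff c v) (diff c ∘L Γ.flip v) := rfl

section Calculus

variable {E : Type*} [NormedAddCommGroup E] [NormedSpace ℝ E] {x : E} {s : Set E} {f : E → ℝ}
  {g : E → EuclideanSpace ℝ (Fin m) →L[ℝ] ℝ}

lemma hasFDerivAt_mk {f' : E →L[ℝ] ℝ} {g' : E →L[ℝ] EuclideanSpace ℝ (Fin m) →L[ℝ] ℝ}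
    {L : E →L[ℝ] Jet m} (hf : HasFDerivAt f f' x) (hg : HasFDerivAt g g' x)
    (hL : ∀ v, L v = mk (f' v) (g' v)) : HasFDerivAt (fun y ↦ mk (f y) (g y)) L x :=
  (hf.prodMk hg).congr_fderiv (ContinuousLinearMap.ext fun v ↦ (hL v).symm)

lemma contDiffOn_mk (hf : ContDiffOn ℝ ∞ f s) (hg : ContDiffOn ℝ ∞ g s) :
    ContDiffOn ℝ ∞ (fun y ↦ mk (f y) (g y)) s :=
  hf.prodMk hg

end Calculus

end Jet

lemma contDiffOn_jetCoeff (A : AffineStructure m M) (x₀ : M) :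
    ContDiffOn ℝ ∞ (fun p ↦ Jet.coeff (christoffelChart A x₀ p)) (coordDomain m x₀) := by
  refine contDiffOn_clm_apply.2 fun v ↦ contDiffOn_clm_apply.2 fun c ↦ ?_
  simp only [Jet.coeff_apply]
  refine Jet.contDiffOn_mk contDiffOn_const (contDiffOn_clm_apply.2 fun w ↦ ?_)
  have h := contDiffOn_clm_apply.1 (contDiffOn_clm_apply.1 (contDiffOn_christoffelChart A x₀) w) v
  exact (Jet.diff c).contDiff.comp_contDiffOn h

set_option synthInstance.maxHeartbeats 200000 in
lemma fderiv_clm_apply_apply {E F : Type*} [NormedAddCommGroup E] [NormedSpace ℝ E]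
    [NormedAddCommGroup F] [NormedSpace ℝ F] {B : E → E →L[ℝ] F →L[ℝ] F} {p : E}
    (hB : DifferentiableAt ℝ B p) (v w : E) (c : F) :
    DifferentiableAt ℝ (fun p ↦ B p w c) p ∧
      fderiv ℝ (fun p ↦ B p w c) p v = fderiv ℝ B p v w c := by
  have h : HasFDerivAt (fun p ↦ B p w c) _ p :=
    (hB.hasFDerivAt.clm_apply (hasFDerivAt_const w p)).clm_apply (hasFDerivAt_const c p)
  exact ⟨h.differentiableAt, by rw [h.fderiv]; simp⟩

-- The value component of the condition is the symmetry of the Christoffel symbols, that is,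
-- vanishing torsion; the differential component is vanishing curvature.
set_option synthInstance.maxHeartbeats 200000 in
lemma integrableAt_jetCoeff {A : AffineStructure m M} (hA : IsFlat A.conn)
    {p : EuclideanSpace ℝ (Fin m)} (hp : p ∈ coordDomain m x₀) :
    IntegrableAt (fun p ↦ Jet.coeff (christoffelChart A x₀ p)) p := by
  have hΓ : DifferentiableAt ℝ (christoffelChart A x₀) p :=
    ((contDiffOn_christoffelChart A x₀).contDiffAt
      ((isOpen_coordDomain x₀).mem_nhds hp)).differentiableAt (by simp)
  have hJ : DifferentiableAt ℝ (fun p ↦ Jet.coeff (christoffelChart A x₀ p)) p :=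
    ((contDiffOn_jetCoeff A x₀).contDiffAt
      ((isOpen_coordDomain x₀).mem_nhds hp)).differentiableAt (by simp)
  have hd (v w : EuclideanSpace ℝ (Fin m)) (c : Jet m) :
      fderiv ℝ (fun p ↦ Jet.coeff (christoffelChart A x₀ p)) p v w c =
        Jet.mk 0 (Jet.diff c ∘L (fderiv ℝ (christoffelChart A x₀) p v).flip w) := by
    obtain ⟨h1, h2⟩ := fderiv_clm_apply_apply hJ v w c
    rw [← h2]
    have hL {G : Type} [NormedAddCommGroup G] [NormedSpace ℝ G] (L : Jet m →L[ℝ] G) :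
        HasFDerivAt (fun p ↦ L (Jet.coeff (christoffelChart A x₀ p) w c))
          (L ∘L fderiv ℝ (fun p ↦ Jet.coeff (christoffelChart A x₀ p) w c) p) p :=
      L.hasFDerivAt.comp p h1.hasFDerivAt
    refine Jet.ext ?_ (ContinuousLinearMap.ext fun u ↦ ?_)
    · have h4 := (hL Jet.val).unique (hasFDerivAt_const (Jet.diff c w) p)
      exact congrArg (fun L : EuclideanSpace ℝ (Fin m) →L[ℝ] ℝ ↦ L v) h4
    · have h3 := (hL Jet.diff).clm_apply (hasFDerivAt_const u p)
      have h4 : HasFDerivAt (fun p ↦ Jet.diff c (christoffelChart A x₀ p u w)) _ p :=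
        (Jet.diff c).hasFDerivAt.comp p ((hΓ.hasFDerivAt.clm_apply
          (hasFDerivAt_const u p)).clm_apply (hasFDerivAt_const w p))
      have h5 := congrArg (fun L : EuclideanSpace ℝ (Fin m) →L[ℝ] ℝ ↦ L v) (h3.unique h4)
      simpa using h5
  intro v w c
  rw [hd, hd]
  refine Jet.ext ?_ (ContinuousLinearMap.ext fun u ↦ ?_)
  · simp only [Jet.coeff_apply, map_add, Jet.val_mk, Jet.diff_mk, zero_add,
      ContinuousLinearMap.comp_apply, ContinuousLinearMap.flip_apply]
    exact congrArg (Jet.diff c) (christoffel_symm A hp.2 w v)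
  · simpa [Jet.coeff_apply] using congrArg (Jet.diff c) (curvature_christoffelChart hA hp v w u)

/-- `f` is smooth at `x` and its Hessian vanishes at `x`. -/
def IsAffineAt (A : AffineStructure m M) (f : M → ℝ) (x : M) : Prop :=
  ContMDiffAt (𝓡 m) 𝓘(ℝ, ℝ) ∞ f x ∧ ∀ X Y : SmoothVF m M, A.hessian f X Y x = 0

lemma IsAffineAt.congr {A : AffineStructure m M} {f f' : M → ℝ} (h : IsAffineAt A f q)
    (hff' : f' =ᶠ[𝓝 q] f) : IsAffineAt A f' q := by
  refine ⟨h.1.congr_of_eventuallyEq hff', fun X Y ↦ ?_⟩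
  rw [← h.2 X Y, AffineStructure.hessian, AffineStructure.hessian, mvfderiv_congr hff',
    mvfderiv_congr (hff'.eventuallyEq_nhds.mono fun x hx ↦ congrArg (· (Y x)) (mvfderiv_congr hx))]

/-- Vanishing of the Hessian expresses the second derivatives through the first ones, which closes
the system for the jet. -/
lemma IsAffineAt.hasFDerivAt {A : AffineStructure m M} {f : M → ℝ} (h : IsAffineAt A f q)
    (hq : q ∈ coordNhd m x₀) :
    HasFDerivAt (fun p ↦ Jet.mk ((f ∘ (extChartAt (𝓡 m) x₀).symm) p)
        (fderiv ℝ (f ∘ (extChartAt (𝓡 m) x₀).symm) p))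
      ((Jet.coeff (christoffelChart A x₀ (extChartAt (𝓡 m) x₀ q))).flip
        (Jet.mk ((f ∘ (extChartAt (𝓡 m) x₀).symm) (extChartAt (𝓡 m) x₀ q))
          (fderiv ℝ (f ∘ (extChartAt (𝓡 m) x₀).symm) (extChartAt (𝓡 m) x₀ q))))
      (extChartAt (𝓡 m) x₀ q) := by
  have hFc := contDiffAt_comp_symm hq.1 le_rfl h.1
  have hess (v w : EuclideanSpace ℝ (Fin m)) := h.2 (coordField x₀ v) (coordField x₀ w)
  simp only [hessian_eq A hq h.1, chartMap_coordField hq, sub_eq_zero] at hess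
  set F := f ∘ (extChartAt (𝓡 m) x₀).symm
  set p := extChartAt (𝓡 m) x₀ q with hp
  have hF' : DifferentiableAt ℝ (fderiv ℝ F) p :=
    (hFc.fderiv_right (m := 1)
      (by rw [one_add_one_eq_two]; exact ENat.LEInfty.out)).differentiableAt one_ne_zero
  have hF : DifferentiableAt ℝ F p := hFc.differentiableAt (by simp)
  refine Jet.hasFDerivAt_mk hF.hasFDerivAt hF'.hasFDerivAt fun v ↦ ?_
  refine Jet.ext rfl (ContinuousLinearMap.ext fun w ↦ Eq.symm ?_)
  rw [ContinuousLinearMap.flip_apply, Jet.coeff_apply]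
  change fderiv ℝ (fderiv ℝ F) p v w = fderiv ℝ F p (christoffelChart A x₀ p w v)
  rw [hess, christoffelChart, hp, (extChartAt (𝓡 m) x₀).left_inv hq.1]

lemma eventually_extChartAt_mem (hq : q ∈ (extChartAt (𝓡 m) x₀).source)
    {s : Set (EuclideanSpace ℝ (Fin m))} (hs : s ∈ 𝓝 (extChartAt (𝓡 m) x₀ q)) :
    ∀ᶠ x in 𝓝 q, extChartAt (𝓡 m) x₀ x ∈ s :=
  (continuousAt_extChartAt' hq).eventually_mem hs

/-- Affine functions with the same jet at a point agree nearby. -/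
lemma eventuallyEq_of_isAffineAt {A : AffineStructure m M} {f f' : M → ℝ}
    (hf : ∀ᶠ x in 𝓝 q, IsAffineAt A f x) (hf' : ∀ᶠ x in 𝓝 q, IsAffineAt A f' x)
    (h0 : f q = f' q) (h1 : mvfderiv (𝓡 m) f q = mvfderiv (𝓡 m) f' q) : f =ᶠ[𝓝 q] f' := by
  have hq := mem_coordNhd (m := m) q
  have hcont : ContinuousAt (extChartAt (𝓡 m) q).symm (extChartAt (𝓡 m) q q) :=
    continuousAt_extChartAt_symm q
  have hev : ∀ᶠ p in 𝓝 (extChartAt (𝓡 m) q q), p ∈ coordDomain m q ∧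
      IsAffineAt A f ((extChartAt (𝓡 m) q).symm p) ∧
      IsAffineAt A f' ((extChartAt (𝓡 m) q).symm p) := by
    rw [ContinuousAt, (extChartAt (𝓡 m) q).left_inv hq.1] at hcont
    exact ((isOpen_coordDomain q).eventually_mem (extChartAt_mem_coordDomain hq)).and
      ((hcont.eventually hf).and (hcont.eventually hf'))
  obtain ⟨r, hr, hball⟩ := Metric.eventually_nhds_iff_ball.1 hev
  have hsol {f : M → ℝ} {p : EuclideanSpace ℝ (Fin m)} (hp : p ∈ coordDomain m q)
      (hf : IsAffineAt A f ((extChartAt (𝓡 m) q).symm p)) := hf.hasFDerivAt hp.2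
  have hsol' {f : M → ℝ} {p : EuclideanSpace ℝ (Fin m)} (hp : p ∈ coordDomain m q)
      (hf : IsAffineAt A f ((extChartAt (𝓡 m) q).symm p)) :
      HasFDerivAt (fun p ↦ Jet.mk ((f ∘ (extChartAt (𝓡 m) q).symm) p)
        (fderiv ℝ (f ∘ (extChartAt (𝓡 m) q).symm) p))
      ((Jet.coeff (christoffelChart A q p)).flip
        (Jet.mk ((f ∘ (extChartAt (𝓡 m) q).symm) p)
          (fderiv ℝ (f ∘ (extChartAt (𝓡 m) q).symm) p))) p := by
    have := hsol hp hf
    rwa [(extChartAt (𝓡 m) q).right_inv hp.1] at this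
  have hA : ContinuousOn (fun p ↦ Jet.coeff (christoffelChart A q p))
      (Metric.ball (extChartAt (𝓡 m) q q) r) :=
    (contDiffOn_jetCoeff A q).continuousOn.mono fun p hp ↦ (hball p hp).1
  have hd (f : M → ℝ) (hf : ∀ᶠ x in 𝓝 q, IsAffineAt A f x) : fderiv ℝ
      (f ∘ (extChartAt (𝓡 m) q).symm) (extChartAt (𝓡 m) q q) = mvfderiv (𝓡 m) f q ∘L
        chartInv q q := by
    ext1 w
    rw [ContinuousLinearMap.comp_apply, mvfderiv_eq_fderiv_comp_symm hq.1
      (hf.self_of_nhds.1.mdifferentiableAt (by simp)), chartMap_chartInv hq.1]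
  have heq := eqOn_of_hasFDerivAt (convex_ball (extChartAt (𝓡 m) q q) r) hA
    (fun p hp ↦ hsol' (hball p hp).1 (hball p hp).2.1)
    (fun p hp ↦ hsol' (hball p hp).1 (hball p hp).2.2) (Metric.mem_ball_self hr) (by
      rw [hd f hf, hd f' hf', h1, Function.comp_apply, Function.comp_apply,
        (extChartAt (𝓡 m) q).left_inv hq.1, h0])
  filter_upwards [eventually_extChartAt_mem hq.1 (Metric.ball_mem_nhds _ hr),
    (isOpen_coordNhd q).mem_nhds hq] with x hx hxq
  have := congrArg Jet.val (heq hx)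
  rwa [Jet.val_mk, Jet.val_mk, Function.comp_apply, Function.comp_apply,
    (extChartAt (𝓡 m) q).left_inv hxq.1] at this

/-- Solutions of the coordinate system give affine functions. -/
lemma isAffineAt_of_hasFDerivAt {A : AffineStructure m M} {s : Set (EuclideanSpace ℝ (Fin m))}
    (hs : IsOpen s) (hsub : s ⊆ coordDomain m x₀) {u : EuclideanSpace ℝ (Fin m) → Jet m}
    (hu : ∀ p ∈ s, HasFDerivAt u ((Jet.coeff (christoffelChart A x₀ p)).flip (u p)) p)
    (hq : q ∈ coordNhd m x₀) (hqs : extChartAt (𝓡 m) x₀ q ∈ s) :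
    IsAffineAt A (fun x ↦ Jet.val (u (extChartAt (𝓡 m) x₀ x))) q ∧
      mvfderiv (𝓡 m) (fun x ↦ Jet.val (u (extChartAt (𝓡 m) x₀ x))) q =
        Jet.diff (u (extChartAt (𝓡 m) x₀ q)) ∘L chartMap x₀ q := by
  have hsmooth : ContDiffOn ℝ ∞ u s :=
    contDiffOn_of_hasFDerivAt hs ((contDiffOn_jetCoeff A x₀).mono hsub) hu
  have h1 (p) (hp : p ∈ s) : HasFDerivAt (fun p ↦ Jet.val (u p)) (Jet.diff (u p)) p := by
    refine (Jet.val.hasFDerivAt.comp p (hu p hp)).congr_fderiv ?_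
    exact ContinuousLinearMap.ext fun v ↦ rfl
  have h2 (p) (hp : p ∈ s) (v w : EuclideanSpace ℝ (Fin m)) :
      fderiv ℝ (fun p ↦ (Jet.diff (u p))) p v w = (Jet.diff (u p)) (christoffelChart A x₀ p w v) := by
    have h : HasFDerivAt (fun p ↦ Jet.diff (u p)) _ p := Jet.diff.hasFDerivAt.comp p (hu p hp)
    rw [h.fderiv]
    rfl
  have hu1 : ContDiffAt ℝ ∞ (fun p ↦ Jet.val (u p)) (extChartAt (𝓡 m) x₀ q) :=
    Jet.val.contDiff.contDiffAt.comp _ (hsmooth.contDiffAt (hs.mem_nhds hqs))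
  have hf : ContMDiffAt (𝓡 m) 𝓘(ℝ, ℝ) ∞ (fun x ↦ Jet.val (u (extChartAt (𝓡 m) x₀ x))) q :=
    ContMDiffAt.comp (I' := 𝓘(ℝ, EuclideanSpace ℝ (Fin m))) (g := fun p ↦ Jet.val (u p)) q
      hu1.contMDiffAt
      (contMDiffAt_extChartAt' (by rw [← extChartAt_source (𝓡 m)]; exact hq.1))
  refine ⟨⟨hf, fun X Y ↦ ?_⟩, ContinuousLinearMap.ext fun w ↦ ?_⟩
  · have hloc : ((fun x ↦ Jet.val (u (extChartAt (𝓡 m) x₀ x))) ∘ (extChartAt (𝓡 m) x₀).symm)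
        =ᶠ[𝓝 (extChartAt (𝓡 m) x₀ q)] fun p ↦ Jet.val (u p) := by
      filter_upwards [hs.mem_nhds hqs] with p hp
      rw [Function.comp_apply, (extChartAt (𝓡 m) x₀).right_inv (hsub hp).1]
    have hloc' : fderiv ℝ (fun p ↦ Jet.val (u p)) =ᶠ[𝓝 (extChartAt (𝓡 m) x₀ q)] fun p ↦ (Jet.diff (u p)) := by
      filter_upwards [hs.mem_nhds hqs] with p hp
      exact (h1 p hp).fderiv
    rw [hessian_eq A hq hf, hloc.fderiv_eq, hloc.fderiv.fderiv_eq, hloc'.fderiv_eq, h2 _ hqs,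
      (h1 _ hqs).fderiv, christoffelChart, (extChartAt (𝓡 m) x₀).left_inv hq.1, sub_self]
  · exact (mvfderiv_comp_extChartAt hq.1 (h1 _ hqs).differentiableAt w).trans (by
      rw [(h1 _ hqs).fderiv]; rfl)

end LocalAffineFunctions

/-! ### Local affine functions with arbitrary jets and their globalization -/

section GlobalAffineFunctions

open Set Filter Topology

variable {m : ℕ} {M : Type*} [TopologicalSpace M] [T2Space M]
  [ChartedSpace (EuclideanSpace ℝ (Fin m)) M] [IsManifold (𝓡 m) ∞ M] {x₀ q : M}

/-- The first order jet of a function at a point. -/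
def jetAt (f : M → ℝ) (x : M) : Jet m :=
  Jet.mk (f x) (mvfderiv (𝓡 m) f x : TangentSpace (𝓡 m) x →L[ℝ] ℝ)

lemma diff_jetAt (f : M → ℝ) (x : M) (v : TangentSpace (𝓡 m) x) :
    (Jet.diff (jetAt f x) : TangentSpace (𝓡 m) x →L[ℝ] ℝ) v = mvfderiv (𝓡 m) f x v := rfl

lemma jetAt_congr {f f' : M → ℝ} (h : f =ᶠ[𝓝 q] f') : jetAt (m := m) f q = jetAt f' q := by
  rw [jetAt, jetAt, h.eq_of_nhds, mvfderiv_congr h]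

/-- Near every point, a flat affine structure has affine functions with arbitrary jets. -/
lemma exists_local_affine {A : AffineStructure m M} (hA : IsFlat A.conn) (x₀ : M) :
    ∃ (V : Set M) (f : Jet m → M → ℝ), IsOpen V ∧ x₀ ∈ V ∧
      (∀ c, ∀ x ∈ V, IsAffineAt A (f c) x) ∧
      ∀ x ∈ V, Function.Bijective fun c ↦ jetAt (m := m) (f c) x := by
  have hsm := contDiffOn_jetCoeff A x₀
  have hx₀ := mem_coordNhd (m := m) x₀
  obtain ⟨r, hr, hsub, hsol⟩ := exists_ball_solutions (hsm.of_le ENat.LEInfty.out)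
    (fun p hp ↦ integrableAt_jetCoeff hA hp)
    ((isOpen_coordDomain x₀).mem_nhds (extChartAt_mem_coordDomain hx₀))
  set s := Metric.ball (extChartAt (𝓡 m) x₀ x₀) r with hs
  have hcenter : extChartAt (𝓡 m) x₀ x₀ ∈ s := Metric.mem_ball_self hr
  choose u hu0 hu using hsol _ hcenter
  have huniq {u u' : EuclideanSpace ℝ (Fin m) → Jet m}
      (hu : ∀ p ∈ s, HasFDerivAt u ((Jet.coeff (christoffelChart A x₀ p)).flip (u p)) p)
      (hu' : ∀ p ∈ s, HasFDerivAt u' ((Jet.coeff (christoffelChart A x₀ p)).flip (u' p)) p)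
      {p : EuclideanSpace ℝ (Fin m)} (hp : p ∈ s) (h : u p = u' p) : EqOn u u' s :=
    eqOn_of_hasFDerivAt (convex_ball _ r) (hsm.continuousOn.mono hsub) hu hu' hp h
  have hopen : IsOpen (coordNhd m x₀ ∩ extChartAt (𝓡 m) x₀ ⁻¹' s) :=
    ((continuousOn_extChartAt x₀).mono fun x hx ↦ hx.1).isOpen_inter_preimage
      (isOpen_coordNhd x₀) Metric.isOpen_ball
  have haff (c : Jet m) {x : M} (hx : x ∈ coordNhd m x₀ ∩ extChartAt (𝓡 m) x₀ ⁻¹' s) :=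
    isAffineAt_of_hasFDerivAt Metric.isOpen_ball hsub (hu c) hx.1 hx.2
  refine ⟨_, fun c x ↦ Jet.val (u c (extChartAt (𝓡 m) x₀ x)), hopen, ⟨hx₀, hcenter⟩,
    fun c x hx ↦ (haff c hx).1, fun x hx ↦ ⟨fun c d hcd ↦ ?_, fun d ↦ ?_⟩⟩
  -- The parameter `c` is the chart jet at the centre. Equal jets at `x` force equal solutions by
  -- uniqueness, hence equal parameters.
  · have h1 := congrArg Jet.val hcd
    have h3 : u c (extChartAt (𝓡 m) x₀ x) = u d (extChartAt (𝓡 m) x₀ x) := by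
      refine Jet.ext h1 (ContinuousLinearMap.ext fun v ↦ ?_)
      have h2 := congrArg (fun c ↦ (Jet.diff c : TangentSpace (𝓡 m) x →L[ℝ] ℝ) (chartInv x₀ x v)) hcd
      rw [diff_jetAt, diff_jetAt, (haff c hx).2, (haff d hx).2, ContinuousLinearMap.comp_apply,
        ContinuousLinearMap.comp_apply, chartMap_chartInv hx.1.1] at h2
      exact h2
    rw [← hu0 c, ← hu0 d]
    exact huniq (hu c) (hu d) hx.2 h3 hcenter
  -- To reach the jet `d` at `x`, solve starting from `x` and take as parameter the value of that
  -- solution at the centre.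
  · obtain ⟨w, hw0, hw⟩ := hsol _ hx.2 (Jet.mk (Jet.val d)
      ((Jet.diff d : TangentSpace (𝓡 m) x →L[ℝ] ℝ) ∘L chartInv x₀ x))
    refine ⟨w (extChartAt (𝓡 m) x₀ x₀), ?_⟩
    have h1 := huniq (hu _) hw hcenter (hu0 _) hx.2
    refine Jet.ext ?_ (ContinuousLinearMap.ext fun v ↦ ?_)
    · exact (congrArg Jet.val (h1.trans hw0)).trans (Jet.val_mk _ _)
    · refine (diff_jetAt _ x v).trans ?_
      rw [(haff _ hx).2, h1, hw0, Jet.diff_mk]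
      exact congrArg (Jet.diff d : TangentSpace (𝓡 m) x →L[ℝ] ℝ) (chartInv_chartMap hx.1.1 v)

/-- Jets with the discrete topology. -/
def DiscreteJet (m : ℕ) : Type := Jet m

instance : TopologicalSpace (DiscreteJet m) := ⊥

instance : DiscreteTopology (DiscreteJet m) := ⟨rfl⟩

/-- On a simply connected manifold with a flat affine structure, there are global affine functions
with arbitrary jets. -/
theorem exists_affine [SimplyConnectedSpace M] {A : AffineStructure m M} (hA : IsFlat A.conn)
    (P : M) (c : Jet m) : ∃ f : M → ℝ, (∀ x, IsAffineAt A f x) ∧ jetAt f P = c := by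
  classical
  have := ChartedSpace.locallyPathConnectedSpace (EuclideanSpace ℝ (Fin m)) M
  choose V f hV hmem haff hbij using exists_local_affine hA
  -- `T i x` sends the parameter of a local affine function near `i` to its jet at `x`; outside `V
  -- i` the identity is a mere filler.
  let T (i x : M) : DiscreteJet m ≃ DiscreteJet m :=
    if hx : x ∈ V i then Equiv.ofBijective _ (hbij i x hx) else Equiv.refl _
  have hT {i x : M} (hx : x ∈ V i) (c : Jet m) : T i x c = jetAt (m := m) (f i c) x := by
    simp only [T, dif_pos hx]
    rfl
  have haff' {i x : M} (hx : x ∈ V i) (c : Jet m) : ∀ᶠ y in 𝓝 x, IsAffineAt A (f i c) y :=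
    ((hV i).eventually_mem hx).mono fun y hy ↦ haff i c y hy
  obtain ⟨s, hsP, hs⟩ := exists_section_of_localSystem V hV hmem T (by
    intro i j x hx c
    set d := (T j x).symm (T i x c) with hd
    have h1 : T j x d = T i x c := by rw [hd, Equiv.apply_symm_apply]
    have h2 : jetAt (m := m) (f j d) x = jetAt (f i c) x :=
      (hT hx.2 d).symm.trans (h1.trans (hT hx.1 c))
    -- Equality of jets at one point propagates to a neighbourhood, so the transition functions are
    -- locally constant.
    have h3 : f j d =ᶠ[𝓝 x] f i c := eventuallyEq_of_isAffineAt (haff' hx.2 d) (haff' hx.1 c)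
      (congrArg Jet.val h2) (congrArg Jet.diff h2)
    filter_upwards [h3.eventuallyEq_nhds, (hV i).eventually_mem hx.1,
      (hV j).eventually_mem hx.2] with y hy hyi hyj
    rw [Equiv.symm_apply_eq]
    exact (hT hyi c).trans ((jetAt_congr hy.symm).trans (hT hyj d).symm)) P c
  have hloc (i : M) : ∃ d, (fun x ↦ Jet.val (s x)) =ᶠ[𝓝 i] f i d ∧ s i = jetAt (m := m) (f i d) i := by
    obtain ⟨d, hd⟩ := hs i
    refine ⟨d, ?_, hd.self_of_nhds.trans (hT (hmem i) d)⟩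
    filter_upwards [hd, (hV i).eventually_mem (hmem i)] with x hx hxi
    rw [hx]
    exact congrArg Jet.val (hT hxi d)
  refine ⟨fun x ↦ Jet.val (s x), fun i ↦ ?_, ?_⟩
  · obtain ⟨d, hd, -⟩ := hloc i
    exact (haff i d i (hmem i)).congr hd
  · obtain ⟨d, hd, hd'⟩ := hloc P
    rw [jetAt_congr hd, ← hd', hsP]

end GlobalAffineFunctions

/-! ### From affine functions of a flat connection to solutions for its projective change -/

section ProjectiveChange

open Set Filter Topology

variable {m : ℕ} {M : Type*} [TopologicalSpace M] [T2Space M]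
  [ChartedSpace (EuclideanSpace ℝ (Fin m)) M] [IsManifold (𝓡 m) ∞ M] {x : M}

/-- `A` arises from `A₀` by the projective change `∇_X Y = ∇⁰_X Y + X(h) Y + Y(h) X`. -/
def IsProjectiveChange (A A₀ : AffineStructure m M) (h : M → ℝ) : Prop :=
  ∀ (Y : Π x : M, TangentSpace (𝓡 m) x) (x : M), VFDiffAt Y x → ∀ v : TangentSpace (𝓡 m) x,
    A.conn Y x v = A₀.conn Y x v + mvfderiv (𝓡 m) h x v • Y x + mvfderiv (𝓡 m) h x (Y x) • v

/-- A strongly projectively flat affine structure is a projective change of a flat one. -/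
lemma AffineStructure.IsStronglyProjectivelyFlat.exists_isProjectiveChange
    {A : AffineStructure m M} (hA : A.IsStronglyProjectivelyFlat) :
    ∃ (A₀ : AffineStructure m M) (h : M → ℝ), IsFlat A₀.conn ∧
      ContMDiff (𝓡 m) 𝓘(ℝ, ℝ) ∞ h ∧ IsProjectiveChange A A₀ h := by
  obtain ⟨A₀, hflat, g, hg⟩ := hA
  -- The flat connection is `^g∇`; solving for `∇` changes the sign of `g`.
  refine ⟨A₀, -g, hflat, g.contMDiff.neg, fun Y x hY v ↦ ?_⟩
  obtain ⟨X, rfl⟩ := exists_smoothVF_apply_eq x v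
  rw [hg Y x hY, perturb_apply A.conn g X Y x, mvfderiv_neg]
  simp only [neg_apply]
  module

/-- The bilinear form `Hess h - dh ⊗ dh`, as a linear form in its first argument. -/
def projForm (A₀ : AffineStructure m M) (h : M → ℝ) (Z : SmoothVF m M) (x : M) :
    TangentSpace (𝓡 m) x →L[ℝ] ℝ :=
  mvfderiv (𝓡 m) (fun q ↦ mvfderiv (𝓡 m) h q (Z q)) x - mvfderiv (𝓡 m) h x ∘L A₀.conn Z x -
    mvfderiv (𝓡 m) h x (Z x) • mvfderiv (𝓡 m) h x

lemma projForm_apply (A₀ : AffineStructure m M) (h : M → ℝ) (X Z : SmoothVF m M) (x : M) :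
    projForm A₀ h Z x (X x) = A₀.hessian h X Z x -
      mvfderiv (𝓡 m) h x (Z x) * mvfderiv (𝓡 m) h x (X x) := rfl

variable {A A₀ : AffineStructure m M} {h : M → ℝ}

lemma projForm_symm (hh : ContMDiff (𝓡 m) 𝓘(ℝ, ℝ) ∞ h) (X Z : SmoothVF m M) (x : M) :
    projForm A₀ h Z x (X x) = projForm A₀ h X x (Z x) := by
  rw [projForm_apply, projForm_apply, A₀.hessian_symm (hh x), mul_comm]

lemma IsProjectiveChange.conn_conn (hA : IsProjectiveChange A A₀ h)
    (hh : ContMDiff (𝓡 m) 𝓘(ℝ, ℝ) ∞ h) (X Y Z : SmoothVF m M) (x : M) :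
    A.conn (fun q ↦ A.conn Z q (Y q)) x (X x) =
      A₀.conn (fun q ↦ A₀.conn Z q (Y q)) x (X x) +
      (mvfderiv (𝓡 m) h x (Y x) • A₀.conn Z x (X x) +
        mvfderiv (𝓡 m) (fun q ↦ mvfderiv (𝓡 m) h q (Y q)) x (X x) • Z x) +
      (mvfderiv (𝓡 m) h x (Z x) • A₀.conn Y x (X x) +
        mvfderiv (𝓡 m) (fun q ↦ mvfderiv (𝓡 m) h q (Z q)) x (X x) • Y x) +
      mvfderiv (𝓡 m) h x (X x) • (A₀.conn Z x (Y x) + mvfderiv (𝓡 m) h x (Y x) • Z x +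
        mvfderiv (𝓡 m) h x (Z x) • Y x) +
      (mvfderiv (𝓡 m) h x (A₀.conn Z x (Y x)) +
        2 * mvfderiv (𝓡 m) h x (Y x) * mvfderiv (𝓡 m) h x (Z x)) • X x := by
  have h0 : (fun q ↦ A.conn Z q (Y q)) = (fun q ↦ A₀.conn Z q (Y q)) +
      (fun q ↦ mvfderiv (𝓡 m) h q (Y q)) • (Z : Π x : M, TangentSpace (𝓡 m) x) +
      (fun q ↦ mvfderiv (𝓡 m) h q (Z q)) • (Y : Π x : M, TangentSpace (𝓡 m) x) :=
    funext fun q ↦ hA Z q (Z.vfDiffAt q) (Y q)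
  have d1 : VFDiffAt (fun q ↦ A₀.conn Z q (Y q)) x := A₀.mdifferentiableAt_conn Z (Y.vfDiffAt x)
  have dY := mdifferentiableAt_mvfderiv_apply (hh x) (Y.vfDiffAt x)
  have dZ := mdifferentiableAt_mvfderiv_apply (hh x) (Z.vfDiffAt x)
  have d2 : VFDiffAt ((fun q ↦ mvfderiv (𝓡 m) h q (Y q)) •
    (Z : Π x : M, TangentSpace (𝓡 m) x)) x := dY.smul_section (Z.vfDiffAt x)
  have d3 : VFDiffAt ((fun q ↦ mvfderiv (𝓡 m) h q (Z q)) •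
    (Y : Π x : M, TangentSpace (𝓡 m) x)) x := dZ.smul_section (Y.vfDiffAt x)
  have d12 := mdifferentiableAt_add_section d1 d2
  have h1 : A₀.conn (fun q ↦ A.conn Z q (Y q)) x = A₀.conn _ x :=
    congrArg (fun W : Π x : M, TangentSpace (𝓡 m) x ↦ A₀.conn W x) h0
  rw [A₀.conn.isCovariantDerivativeOnUniv.add d12 d3,
    A₀.conn.isCovariantDerivativeOnUniv.add d1 d2,
    A₀.conn.isCovariantDerivativeOnUniv.leibniz (Z.vfDiffAt x) dY,
    A₀.conn.isCovariantDerivativeOnUniv.leibniz (Y.vfDiffAt x) dZ] at h1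
  rw [hA _ x (A.mdifferentiableAt_conn Z (Y.vfDiffAt x)), h1]
  simp only [hA Z x (Z.vfDiffAt x), add_apply, smul_apply, ContinuousLinearMap.smulRight_apply,
    map_add, map_smul, smul_eq_mul]
  module

/-- The curvature of a projective change of a flat connection. -/
lemma IsProjectiveChange.curvature_eq (hA : IsProjectiveChange A A₀ h) (hflat : IsFlat A₀.conn)
    (hh : ContMDiff (𝓡 m) 𝓘(ℝ, ℝ) ∞ h) (X Y Z : SmoothVF m M) (x : M) :
    curvature A.conn X Y Z x =
      projForm A₀ h Z x (X x) • Y x - projForm A₀ h Z x (Y x) • X x := by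
  have hb := (CovariantDerivative.torsion_eq_zero_iff A₀.conn).1 A₀.torsion_free
    (X.vfDiffAt x) (Y.vfDiffAt x)
  have hs := A₀.hessian_symm (hh x) X Y
  have h0 := hflat X Y Z x
  rw [AffineStructure.hessian, AffineStructure.hessian] at hs
  rw [curvature, ← hb] at h0 ⊢
  rw [hA.conn_conn hh, hA.conn_conn hh, hA Z x (Z.vfDiffAt x), projForm_apply, projForm_apply,
    AffineStructure.hessian, AffineStructure.hessian]
  -- Symmetry of the Hessian of `h` makes the coefficient of `Z` cancel in the antisymmetrization.
  have hs' : mvfderiv (𝓡 m) (fun q ↦ mvfderiv (𝓡 m) h q (Y q)) x (X x) =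
      mvfderiv (𝓡 m) (fun q ↦ mvfderiv (𝓡 m) h q (X q)) x (Y x) +
        mvfderiv (𝓡 m) h x (A₀.conn Y x (X x) - A₀.conn X x (Y x)) := by
    rw [map_sub]; linarith
  rw [hs']
  rw [sub_sub, sub_eq_zero] at h0
  rw [h0]
  module

/-- With `K = Hess h - dh ⊗ dh`, the map `X ↦ K(X, Z) Y - K(Y, Z) X` has trace `K(Y, Z) - m K(Y,
Z)`: a rank-one part and a multiple of the identity. -/
lemma IsProjectiveChange.ricci_eq (hA : IsProjectiveChange A A₀ h) (hflat : IsFlat A₀.conn)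
    (hh : ContMDiff (𝓡 m) 𝓘(ℝ, ℝ) ∞ h) (Y Z : SmoothVF m M) (x : M) :
    A.ricci Y Z x = -((m : ℝ) - 1) * projForm A₀ h Z x (Y x) := by
  have h0 : (TensorialAt.mkHom (fun X ↦ curvature A.conn X Y Z x) x
      (A.tensorialAt_curvature Y Z x)).toLinearMap =
      ((projForm A₀ h Z x).toLinearMap.smulRight (Y x) : TangentSpace (𝓡 m) x →ₗ[ℝ] _) -
        projForm A₀ h Z x (Y x) • LinearMap.id := by
    refine LinearMap.ext fun v ↦ ?_
    obtain ⟨X, rfl⟩ := exists_smoothVF_apply_eq x v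
    exact (TensorialAt.mkHom_apply (A.tensorialAt_curvature Y Z x) (X.vfDiffAt x)).trans
      (hA.curvature_eq hflat hh X Y Z x)
  have hfin : Module.finrank ℝ (TangentSpace (𝓡 m) x) = m :=
    finrank_euclideanSpace_fin (𝕜 := ℝ) (n := m)
  have : Module.Free ℝ (TangentSpace (𝓡 m) x) :=
    inferInstanceAs (Module.Free ℝ (EuclideanSpace ℝ (Fin m)))
  have : Module.Finite ℝ (TangentSpace (𝓡 m) x) :=
    inferInstanceAs (Module.Finite ℝ (EuclideanSpace ℝ (Fin m)))
  rw [AffineStructure.ricci, h0, map_sub, map_smul, LinearMap.trace_smulRight, LinearMap.trace_id,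
    hfin, ContinuousLinearMap.coe_coe, smul_eq_mul]
  ring

lemma mvfderiv_exp {h : M → ℝ} (hh : MDifferentiableAt (𝓡 m) 𝓘(ℝ, ℝ) h x)
    (v : TangentSpace (𝓡 m) x) :
    mvfderiv (𝓡 m) (fun x ↦ Real.exp (h x)) x v = Real.exp (h x) * mvfderiv (𝓡 m) h x v := by
  have h1 := mfderiv_comp_apply x (Real.differentiableAt_exp (x := h x)).mdifferentiableAt hh v
  rw [mfderiv_eq_fderiv, (Real.hasDerivAt_exp (h x)).hasFDerivAt.fderiv] at h1
  exact h1.trans (mul_comm (mvfderiv (𝓡 m) h x v) (Real.exp (h x)))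

lemma mvfderiv_exp_mul {h f : M → ℝ} (hh : MDifferentiableAt (𝓡 m) 𝓘(ℝ, ℝ) h x)
    (hf : MDifferentiableAt (𝓡 m) 𝓘(ℝ, ℝ) f x) (v : TangentSpace (𝓡 m) x) :
    mvfderiv (𝓡 m) (fun x ↦ Real.exp (h x) * f x) x v =
      Real.exp (h x) * (mvfderiv (𝓡 m) h x v * f x + mvfderiv (𝓡 m) f x v) := by
  have he : MDifferentiableAt (𝓡 m) 𝓘(ℝ, ℝ) (fun x ↦ Real.exp (h x)) x :=
    Real.differentiableAt_exp.comp_mdifferentiableAt hh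
  rw [mvfderiv_fun_mul he hf]
  simp only [add_apply, smul_apply, mvfderiv_exp hh, smul_eq_mul]
  ring

/-- The mixed terms in `dh` and `df` cancel and leave `Hess (e^h f) = e^h (Hess⁰ f + f (Hess⁰ h - dh
⊗ dh))`. The last term is what the Ricci term compensates, once `m - 1` can be cancelled. -/
lemma IsProjectiveChange.exp_mul_mem_solutionSpace (hA : IsProjectiveChange A A₀ h)
    (hm : 2 ≤ m) (hflat : IsFlat A₀.conn) (hh : ContMDiff (𝓡 m) 𝓘(ℝ, ℝ) ∞ h)
    {f : M → ℝ} (hf : ∀ x, IsAffineAt A₀ f x) :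
    (fun x ↦ Real.exp (h x) * f x) ∈ A.solutionSpace := by
  have hfs : ContMDiff (𝓡 m) 𝓘(ℝ, ℝ) ∞ f := fun x ↦ (hf x).1
  have hes : ContMDiff (𝓡 m) 𝓘(ℝ, ℝ) ∞ fun x ↦ Real.exp (h x) :=
    Real.contDiff_exp.contMDiff.comp hh
  have hfd (x : M) := (hfs x).mdifferentiableAt (by simp)
  have hhd (x : M) := (hh x).mdifferentiableAt (by simp)
  have hd (x : M) (v : TangentSpace (𝓡 m) x) := mvfderiv_exp_mul (hhd x) (hfd x) v
  refine ⟨hes.mul hfs, fun X Y x ↦ ?_⟩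
  have hm' : (m : ℝ) - 1 ≠ 0 := by
    have : (2 : ℝ) ≤ m := by exact_mod_cast hm
    linarith
  have hdY := mdifferentiableAt_mvfderiv_apply (hh x) (Y.vfDiffAt x)
  have hdf := mdifferentiableAt_mvfderiv_apply (hfs x) (Y.vfDiffAt x)
  have hess := (hf x).2 X Y
  have hK := projForm_apply A₀ h X Y x
  rw [AffineStructure.hessian] at hess hK ⊢
  have h1 : (fun q ↦ mvfderiv (𝓡 m) (fun x ↦ Real.exp (h x) * f x) q (Y q)) = fun q ↦
      Real.exp (h q) * (mvfderiv (𝓡 m) h q (Y q) * f q + mvfderiv (𝓡 m) f q (Y q)) :=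
    funext fun q ↦ hd q (Y q)
  have hdYf : MDifferentiableAt (𝓡 m) 𝓘(ℝ, ℝ) (fun q ↦ mvfderiv (𝓡 m) h q (Y q) * f q) x :=
    hdY.mul (hfd x)
  have hsum : MDifferentiableAt (𝓡 m) 𝓘(ℝ, ℝ)
      (fun q ↦ mvfderiv (𝓡 m) h q (Y q) * f q + mvfderiv (𝓡 m) f q (Y q)) x := hdYf.add hdf
  rw [h1, mvfderiv_exp_mul (hhd x) hsum, mvfderiv_fun_add hdYf hdf, mvfderiv_fun_mul hdY (hfd x),
    hd,
    hA Y x (Y.vfDiffAt x), AffineStructure.ricciSym, hA.ricci_eq hflat hh, hA.ricci_eq hflat hh,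
    projForm_symm hh Y X x, hK]
  simp only [add_apply, smul_apply, smul_eq_mul, map_add, map_smul]
  field_simp
  linear_combination 2 * Real.exp (h x) * hess

/-- Solutions of the affine quasi-Einstein equation on a simply connected strongly projectively flat
affine manifold separate tangent vectors. -/
theorem AffineStructure.IsStronglyProjectivelyFlat.exists_mem_solutionSpace
    [SimplyConnectedSpace M] (hA : A.IsStronglyProjectivelyFlat) (hm : 2 ≤ m) (x : M)
    (α : TangentSpace (𝓡 m) x →L[ℝ] ℝ) :
    ∃ f ∈ A.solutionSpace, f x = 0 ∧ mvfderiv (𝓡 m) f x = α := by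
  obtain ⟨A₀, h, hflat, hh, hAh⟩ := hA.exists_isProjectiveChange
  -- Since `f x = 0`, the differential of `e^h f` at `x` is `e^{h x} df`; the factor `e^{-h x}`
  -- compensates.
  obtain ⟨f, hf, hfx⟩ := exists_affine hflat x (Jet.mk 0 (Real.exp (-h x) • α))
  have h0 : f x = 0 := congrArg Jet.val hfx
  refine ⟨_, hAh.exp_mul_mem_solutionSpace hm hflat hh hf, by simp [h0], ?_⟩
  refine ContinuousLinearMap.ext fun v ↦ ?_
  have hv : mvfderiv (𝓡 m) f x v = Real.exp (-h x) * α v := by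
    rw [← diff_jetAt, hfx]
    rfl
  rw [mvfderiv_exp_mul ((hh x).mdifferentiableAt (by simp))
    ((hf x).1.mdifferentiableAt (by simp)), hv, h0, mul_zero, zero_add, ← mul_assoc,
    ← Real.exp_add, add_neg_cancel, Real.exp_zero, one_mul]

end ProjectiveChange

/-! ### Recovering the connection from its solutions -/

section Rigidity

open Set Filter Topology

variable {m : ℕ} {M : Type*} [TopologicalSpace M] [T2Space M]
  [ChartedSpace (EuclideanSpace ℝ (Fin m)) M] [IsManifold (𝓡 m) ∞ M] {x : M}

/-- Connections which agree on smooth vector fields are the same. -/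
lemma sameConnection_of_smoothVF {D D' : TangentConnection m M}
    (h : ∀ (Y : SmoothVF m M) (x : M), D Y x = D' Y x) : SameConnection D D' := by
  intro Y x hY
  obtain ⟨Z, hZ⟩ := exists_smoothVF_apply_eq x (Y x)
  -- The difference of two connections is tensorial, so `Y` may be replaced by a smooth field with
  -- the same value at `x`.
  have hd {W : Π x : M, TangentSpace (𝓡 m) x} (hW : VFDiffAt W x) :
      D.isCovariantDerivativeOnUniv.difference D'.isCovariantDerivativeOnUniv x (W x) =
        D W x - D' W x :=
    IsCovariantDerivativeOn.difference_apply _ _ (hσ := hW)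
  rw [← sub_eq_zero]
  refine (hd hY).symm.trans ?_
  rw [← hZ, hd (Z.vfDiffAt x)]
  exact sub_eq_zero.2 (h Z x)

lemma mfderiv_symm_mfderiv (Ξ : M ≃ₘ⟮𝓡 m, 𝓡 m⟯ M) (x : M) (v : TangentSpace (𝓡 m) x) :
    (mfderiv (𝓡 m) (𝓡 m) Ξ.symm (Ξ x)) (mfderiv (𝓡 m) (𝓡 m) Ξ x v) = v := by
  have h1 : MDifferentiableAt (𝓡 m) (𝓡 m) Ξ x := Ξ.contMDiff.mdifferentiable (by simp) x
  have h2 : MDifferentiableAt (𝓡 m) (𝓡 m) Ξ.symm (Ξ x) :=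
    Ξ.symm.contMDiff.mdifferentiable (by simp) _
  have h3 := mfderiv_comp_apply x h2 h1 v
  have h4 : (Ξ.symm ∘ Ξ : M → M) = id := funext fun y ↦ Ξ.symm_apply_apply y
  rw [h4, mfderiv_id] at h3
  exact h3.symm

lemma isInvertible_mfderiv (Ξ : M ≃ₘ⟮𝓡 m, 𝓡 m⟯ M) (x : M) :
    (mfderiv (𝓡 m) (𝓡 m) Ξ x).IsInvertible :=
  ⟨Ξ.mfderivToContinuousLinearEquiv (by simp) x, rfl⟩

lemma mpullback_symm_apply (Ξ : M ≃ₘ⟮𝓡 m, 𝓡 m⟯ M) (Y : Π x : M, TangentSpace (𝓡 m) x) (x : M) :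
    mpullback (𝓡 m) (𝓡 m) Ξ.symm Y (Ξ x) = mfderiv (𝓡 m) (𝓡 m) Ξ x (Y x) := by
  -- The points `Ξ.symm (Ξ x)` and `x` are only propositionally equal; comparing in the model space
  -- avoids a transport between tangent spaces.
  have h : (Y (Ξ.symm (Ξ x)) : EuclideanSpace ℝ (Fin m)) = Y x :=
    congrArg (fun y ↦ (Y y : EuclideanSpace ℝ (Fin m))) (Ξ.symm_apply_apply x)
  rw [mpullback_apply, (isInvertible_mfderiv Ξ.symm (Ξ x)).inverse_apply_eq]
  exact h.trans (mfderiv_symm_mfderiv Ξ x (Y x)).symm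

/-- The push-forward of a smooth vector field by a diffeomorphism. -/
def pushforwardVF (Ξ : M ≃ₘ⟮𝓡 m, 𝓡 m⟯ M) (Y : SmoothVF m M) : SmoothVF m M :=
  ⟨mpullback (𝓡 m) (𝓡 m) Ξ.symm Y,
    ContMDiff.mpullback_vectorField (n := ∞) Y.contMDiff Ξ.symm.contMDiff
      (isInvertible_mfderiv Ξ.symm) (by simp)⟩

lemma pullbackConnection_refl (D : TangentConnection m M) (Y : Π x : M, TangentSpace (𝓡 m) x)
    (x : M) : pullbackConnection (Diffeomorph.refl (𝓡 m) M ∞) D Y x = D Y x := by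
  change (mfderiv (𝓡 m) (𝓡 m) id x).inverse ∘L (D (mpullback (𝓡 m) (𝓡 m) id Y) x) ∘L
    (mfderiv (𝓡 m) (𝓡 m) id x) = _
  rw [mpullback_id, mfderiv_id]
  exact congrArg (fun L : TangentSpace (𝓡 m) x →L[ℝ] TangentSpace (𝓡 m) x ↦ L ∘L D Y x)
    ContinuousLinearMap.inverse_id

/-- If `f ∘ Ξ` solves the second equation whenever `f` solves the first, then the second connection
is the pullback of the first. -/
theorem sameConnection_pullbackConnection [SimplyConnectedSpace M] (hm : 2 ≤ m)
    {A₁ A₂ : AffineStructure m M} (h₁ : A₁.IsStronglyProjectivelyFlat) (Ξ : M ≃ₘ⟮𝓡 m, 𝓡 m⟯ M)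
    (hQ : ∀ f ∈ A₁.solutionSpace, f ∘ Ξ ∈ A₂.solutionSpace) :
    SameConnection (pullbackConnection Ξ A₁.conn) A₂.conn := by
  refine sameConnection_of_smoothVF fun Y x ↦ ContinuousLinearMap.ext fun v ↦ ?_
  have hΞ (y : M) : MDifferentiableAt (𝓡 m) (𝓡 m) Ξ y := Ξ.contMDiff.mdifferentiable (by simp) y
  obtain ⟨X, rfl⟩ := exists_smoothVF_apply_eq x v
  -- `X'` need only match the push-forward of `X` at `Ξ x`, because the Hessian uses just the value
  -- of its first field. For `Y` the full push-forward is required.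
  obtain ⟨X', hX'⟩ := exists_smoothVF_apply_eq (Ξ x) (mfderiv (𝓡 m) (𝓡 m) Ξ x (X x))
  suffices h : A₁.conn (pushforwardVF Ξ Y) (Ξ x) (mfderiv (𝓡 m) (𝓡 m) Ξ x (X x)) =
      mfderiv (𝓡 m) (𝓡 m) Ξ x (A₂.conn Y x (X x)) from
    (isInvertible_mfderiv Ξ x).inverse_apply_eq.2 h
  suffices h : ∀ α : TangentSpace (𝓡 m) (Ξ x) →L[ℝ] ℝ,
      α (A₁.conn (pushforwardVF Ξ Y) (Ξ x) (mfderiv (𝓡 m) (𝓡 m) Ξ x (X x))) =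
        α (mfderiv (𝓡 m) (𝓡 m) Ξ x (A₂.conn Y x (X x))) by
    have h' (α : EuclideanSpace ℝ (Fin m) →L[ℝ] ℝ) := h α
    exact (SeparatingDual.eq_iff_forall_dual_eq (R := ℝ) (V := EuclideanSpace ℝ (Fin m))).2 h'
  intro α
  obtain ⟨f, hf, hfx, rfl⟩ := h₁.exists_mem_solutionSpace hm (Ξ x) α
  have hfd (y : M) : MDifferentiableAt (𝓡 m) 𝓘(ℝ, ℝ) f y :=
    (hf.1 y).mdifferentiableAt (by simp)
  have e1 := hf.2 X' (pushforwardVF Ξ Y) (Ξ x)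
  have e2 := (hQ f hf).2 X Y x
  rw [Function.comp_apply] at e2
  -- As `f` vanishes at `Ξ x`, both equations lose their Ricci term and read `X (Y f) = (∇_X Y) f`.
  rw [hfx, mul_zero, zero_mul, add_zero, AffineStructure.hessian, sub_eq_zero] at e1 e2
  have hcomp (y : M) (w : TangentSpace (𝓡 m) y) : mvfderiv (𝓡 m) (f ∘ Ξ) y w =
      mvfderiv (𝓡 m) f (Ξ y) (mfderiv (𝓡 m) (𝓡 m) Ξ y w) :=
    mvfderiv_comp_apply y (hfd _) (hΞ y) w
  -- Naturality, `Y (f ∘ Ξ) = ((Ξ_* Y) f) ∘ Ξ`, identifies the left sides of the two equations.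
  have hY : (fun q ↦ mvfderiv (𝓡 m) (f ∘ Ξ) q (Y q)) =
      (fun q ↦ mvfderiv (𝓡 m) f q (pushforwardVF Ξ Y q)) ∘ Ξ := by
    funext q
    rw [hcomp, Function.comp_apply]
    exact congrArg (mvfderiv (𝓡 m) f (Ξ q)) (mpullback_symm_apply Ξ Y q).symm
  rw [hY, mvfderiv_comp_apply x (mdifferentiableAt_mvfderiv_apply (hf.1 _)
    ((pushforwardVF Ξ Y).vfDiffAt _)) (hΞ x), hcomp] at e2
  rw [hX'] at e1
  rw [← e1, e2]

end Rigidity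

end AffineGeometry

end

open AffineGeometry in
theorem theorem1p4 {m : ℕ} (hm : 2 ≤ m) {M : Type*} [TopologicalSpace M] [T2Space M]
    [ChartedSpace (EuclideanSpace ℝ (Fin m)) M] [IsManifold (𝓡 m) ∞ M] [SimplyConnectedSpace M]
    (A₁ A₂ : AffineStructure m M)
    (h₁ : A₁.IsStronglyProjectivelyFlat) (h₂ : A₂.IsStronglyProjectivelyFlat)
    (Ξ : M ≃ₘ⟮𝓡 m, 𝓡 m⟯ M) :
    (A₁.solutionSpace = A₂.solutionSpace → SameConnection A₁.conn A₂.conn) ∧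
    ((fun f : M → ℝ ↦ f ∘ Ξ) '' A₁.solutionSpace = A₂.solutionSpace →
      SameConnection (pullbackConnection Ξ A₁.conn) A₂.conn) := by
  refine ⟨fun h Y x hY ↦ ?_, fun h ↦ ?_⟩
  · rw [← sameConnection_pullbackConnection (A₂ := A₂) hm h₁ (Diffeomorph.refl (𝓡 m) M ∞)
      (fun f hf ↦ h ▸ hf) Y x hY, pullbackConnection_refl]
  · exact sameConnection_pullbackConnection hm h₁ Ξ fun f hf ↦ h ▸ ⟨f, hf, rfl⟩
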